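/- Let $k\ge 1$ and $n\ge 0$ be integers and let $a\in C^\infty(\mathbf R)$ be real valued with $a(0)=2n+1$. Fix $\delta_0>0$ and a cutoff $\zeta\in C_0^\infty(\mathbf R)$ with $\zeta=1$ for $|x|\le\delta_0$ and $\zeta$ supported in $\{|x|\le 2\delta_0\}$, and put $b(s)=(a(s)-a(0))\zeta(s)$. For real $z,\epsilon$ let $$B_{z,\epsilon}=-\partial_y^2+p_\epsilon(y)^2-[a(0)+b(z+\epsilon z y)]\,p_\epsilon'(y),\qquad p_\epsilon(y)=(\epsilon k)^{-1}\big((1+\epsilon y)^k-1\big)\ (\epsilon\ne0),\quad p_0(y)=y,$$ acting on $L^2(\mathbf R)$. Then there exist $\theta>0$ and $\epsilon_0>0$ such that for every real $\epsilon$ with $|\epsilon|<\epsilon_0$ the operator $B_{0,\epsilon}$ has exactly one eigenvalue $\lambda(0,\epsilon)$ in $[-\theta,\theta]$. This eigenvalue has an asymptotic expansion to all orders, $\lambda(0,\epsilon)\sim\sum_{j\ge0}\Lambda_j\epsilon^j$ as $\epsilon\to0$, that is, $\lambda(0,\epsilon)-\sum_{j<N}\Lambda_j\epsilon^j=O(|\epsilon|^N)$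 for every $N\ge 0$, and its coefficients satisfy $$\Lambda_1=0,\qquad \Lambda_2=\frac{(k-1)\,n(n+1)}{2}.$$ -/

import Mathlib

open scoped ContDiff

/-- `ζ` is a smooth cutoff function, equal to `1` where `|x| ≤ δ₀` and supported
where `|x| ≤ 2 δ₀`. -/
def IsCutoff (δ₀ : ℝ) (ζ : ℝ → ℝ) : Prop :=
  ContDiff ℝ ∞ ζ ∧ (∀ x, |x| ≤ δ₀ → ζ x = 1) ∧ tsupport ζ ⊆ {x | |x| ≤ 2 * δ₀}

/-- `b(s) = (a(s) - a(0)) ζ(s)`. -/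
def bFun (a ζ : ℝ → ℝ) (s : ℝ) : ℝ := (a s - a 0) * ζ s

/-- `p_ε(y) = (ε k)⁻¹ ((1 + ε y)^k - 1)`, extended by continuity to `p_0(y) = y`. -/
noncomputable def pFun (k : ℕ) (ε y : ℝ) : ℝ :=
  if ε = 0 then y else (ε * k)⁻¹ * ((1 + ε * y) ^ k - 1)

/-- The differential expression
`B_{z,ε} φ = -φ'' + (p_ε² - [a(0) + b(z + ε z y)] p_ε') φ`. -/
noncomputable def opB (k : ℕ) (a ζ : ℝ → ℝ) (z ε : ℝ) (φ : ℝ → ℝ) (y : ℝ) : ℝ :=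
  -iteratedDeriv 2 φ y +
    (pFun k ε y ^ 2 - (a 0 + bFun a ζ (z + ε * z * y)) * deriv (pFun k ε) y) * φ y

/-- `μ` is an eigenvalue of `B_{z,ε}` on `L²(ℝ)`: there is a nonzero square integrable
solution of `B_{z,ε} φ = μ φ`. The coefficients are real and smooth, so eigenfunctions may be
taken real valued and are classical solutions. -/
def IsEigenvalueB (k : ℕ) (a ζ : ℝ → ℝ) (z ε μ : ℝ) : Prop :=
  ∃ φ : ℝ → ℝ, ContDiff ℝ 2 φ ∧ MeasureTheory.MemLp φ 2 MeasureTheory.volume ∧ φ ≠ 0 ∧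
    ∀ y, opB k a ζ z ε φ y = μ * φ y

/-- `f(ε) ~ ∑_{j ≥ 0} c_j ε^j` as `ε → 0`. -/
def HasAsymptoticExpansionAtZero (f : ℝ → ℝ) (c : ℕ → ℝ) : Prop :=
  ∀ N : ℕ, (fun ε => f ε - ∑ j ∈ Finset.range N, c j * ε ^ j) =O[nhds (0 : ℝ)]
    (fun ε => ε ^ N)

open MeasureTheory Filter Topology Set

/-!
At `z = 0` the cutoff term vanishes, so `B_{0,ε} = -d²/dy² + q_ε` with
`q_ε = p_ε² - (2n+1) p_ε'`, a perturbation of the shifted harmonic oscillator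
`-d²/dy² + y² - (2n+1)`. Although `q_ε - q_0` is unbounded relative to `q_0`, the potential `q_ε`
is bounded below by `1/2` for `|y| ≥ R₀`, uniformly in small `ε`. Hence for `|μ| ≤ θ` there are
unique normalised solutions decaying at `+∞` and at `-∞`, and by Gronwall and integral estimates on
the tails both stay close to the Hermite function `h` on `[-R, R]`. An eigenvalue is a zero of their
Wronskian; two different eigenvalues would have orthogonal eigenfunctions that are both close to
`h`, so there is at most one.

For existence and the expansion, formal perturbation theory in `ℝ[y][ε]` gives polynomials times
Gaussians which solve the equation up to `O(ε^N)`. Pairing such a quasimode with the decaying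
solutions shows that the Wronskian changes sign within `O(ε^N)` of the approximate eigenvalue
`∑_{j<N} Λ_j ε^j`, and the intermediate value theorem applies.
-/

/-! ### Linear differential equations -/

/-- Terms of the Picard series of the linear equation `x' = A x`, `x t₀ = x₀`. -/
noncomputable def picardTerm {E : Type*} [NormedAddCommGroup E] [NormedSpace ℝ E]
    (A : ℝ → E →L[ℝ] E) (t₀ : ℝ) (x₀ : E) : ℕ → ℝ → E
  | 0 => fun _ => x₀
  | j + 1 => fun t => ∫ s in t₀..t, A s (picardTerm A t₀ x₀ j s)

section Picard

variable {E : Type*} [NormedAddCommGroup E] [NormedSpace ℝ E] {A : ℝ → E →L[ℝ] E}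
  {t₀ : ℝ} {x₀ : E}

lemma continuous_picardTerm (hA : Continuous A) (j : ℕ) :
    Continuous (picardTerm A t₀ x₀ j) := by
  induction j with
  | zero => exact continuous_const
  | succ j ih =>
    exact intervalIntegral.continuous_primitive
      (fun a b => (hA.clm_apply ih).intervalIntegrable a b) t₀

lemma hasDerivAt_picardTerm_succ [CompleteSpace E] (hA : Continuous A) (j : ℕ) (t : ℝ) :
    HasDerivAt (picardTerm A t₀ x₀ (j + 1)) (A t (picardTerm A t₀ x₀ j t)) t := by
  have hc : Continuous fun s => A s (picardTerm A t₀ x₀ j s) :=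
    hA.clm_apply (continuous_picardTerm hA j)
  exact intervalIntegral.integral_hasDerivAt_right (hc.intervalIntegrable _ _)
    hc.aestronglyMeasurable.stronglyMeasurableAtFilter hc.continuousAt

lemma picardTerm_succ_self (A : ℝ → E →L[ℝ] E) (t₀ : ℝ) (x₀ : E) (j : ℕ) :
    picardTerm A t₀ x₀ (j + 1) t₀ = 0 := by
  simp [picardTerm]

lemma norm_picardTerm_le (hA : Continuous A) {T M : ℝ} (hM : 0 ≤ M)
    (hb : ∀ t, |t - t₀| ≤ T → ‖A t‖ ≤ M) (j : ℕ) {t : ℝ} (ht : |t - t₀| ≤ T) :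
    ‖picardTerm A t₀ x₀ j t‖ ≤ ‖x₀‖ * ((M * |t - t₀|) ^ j / j.factorial) := by
  induction j generalizing t with
  | zero => simp [picardTerm]
  | succ j ih =>
    have integrand_le : ∀ s ∈ uIoc t₀ t, ‖A s (picardTerm A t₀ x₀ j s)‖ ≤
        (‖x₀‖ * M ^ (j + 1) / j.factorial) * |s - t₀| ^ j := by
      intro s hs
      have hs' : |s - t₀| ≤ T :=
        (abs_sub_left_of_mem_uIcc (uIoc_subset_uIcc hs)).trans ht
      calc ‖A s (picardTerm A t₀ x₀ j s)‖ ≤ ‖A s‖ * ‖picardTerm A t₀ x₀ j s‖ :=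
            (A s).le_opNorm _
        _ ≤ M * (‖x₀‖ * ((M * |s - t₀|) ^ j / j.factorial)) := by
            gcongr
            · exact hb s hs'
            · exact ih hs'
        _ = _ := by rw [mul_pow]; ring
    calc ‖picardTerm A t₀ x₀ (j + 1) t‖
        ≤ ∫ s in uIoc t₀ t, ‖A s (picardTerm A t₀ x₀ j s)‖ :=
          intervalIntegral.norm_integral_le_integral_norm_uIoc
      _ ≤ ∫ s in uIoc t₀ t, (‖x₀‖ * M ^ (j + 1) / j.factorial) * |s - t₀| ^ j := by
          refine setIntegral_mono_on ?_ ?_ measurableSet_uIoc integrand_le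
          · exact ((hA.clm_apply (continuous_picardTerm hA j)).norm.integrableOn_uIcc).mono_set
              uIoc_subset_uIcc
          · exact (Continuous.integrableOn_uIcc (by fun_prop)).mono_set uIoc_subset_uIcc
      _ = ‖x₀‖ * ((M * |t - t₀|) ^ (j + 1) / (j + 1).factorial) := by
          rw [integral_const_mul, integral_pow_abs_sub_uIoc, mul_pow, Nat.factorial_succ]
          push_cast
          field_simp

lemma exists_summable_bound_picardTerm (hA : Continuous A) (t₀ T : ℝ) (x₀ : E) (hT : 0 ≤ T) :
    ∃ M : ℝ, ∃ u : ℕ → ℝ, Summable u ∧ 0 ≤ M ∧ ∀ t, |t - t₀| ≤ T →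
      ‖A t‖ ≤ M ∧ ∀ j, ‖picardTerm A t₀ x₀ j t‖ ≤ u j := by
  obtain ⟨M, hball⟩ := (isCompact_closedBall t₀ T).exists_bound_of_continuousOn hA.continuousOn
  have hb : ∀ t, |t - t₀| ≤ T → ‖A t‖ ≤ M := fun t ht => hball t (by simpa [Real.dist_eq])
  have hM : 0 ≤ M := (norm_nonneg _).trans (hb t₀ (by simpa))
  refine ⟨M, fun j => ‖x₀‖ * ((M * T) ^ j / j.factorial),
    (Real.summable_pow_div_factorial _).mul_left _, hM, fun t ht => ⟨hb t ht, fun j => ?_⟩⟩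
  exact (norm_picardTerm_le hA hM hb j ht).trans (by beta_reduce; gcongr)

lemma summable_picardTerm [CompleteSpace E] (hA : Continuous A) (t₀ : ℝ) (x₀ : E) (t : ℝ) :
    Summable fun j => picardTerm A t₀ x₀ j t := by
  obtain ⟨M, u, hu, -, hb⟩ := exists_summable_bound_picardTerm hA t₀ |t - t₀| x₀ (abs_nonneg _)
  exact Summable.of_norm_bounded hu (hb t le_rfl).2

lemma hasDerivAt_tsum_picardTerm_succ [CompleteSpace E] (hA : Continuous A) (t₀ : ℝ) (x₀ : E)
    (t : ℝ) :
    HasDerivAt (fun t => ∑' j, picardTerm A t₀ x₀ (j + 1) t)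
      (A t (∑' j, picardTerm A t₀ x₀ j t)) t := by
  have hT : 0 < |t - t₀| + 1 := by positivity
  obtain ⟨M, u, hu, hM, hb⟩ := exists_summable_bound_picardTerm hA t₀ (|t - t₀| + 1) x₀ hT.le
  rw [(A t).map_tsum (summable_picardTerm hA t₀ x₀ t)]
  refine hasDerivAt_tsum_of_isPreconnected (t := Metric.ball t₀ (|t - t₀| + 1)) (y₀ := t₀)
    (hu.mul_left M) Metric.isOpen_ball (convex_ball t₀ _).isPreconnected
    (fun j s _ => hasDerivAt_picardTerm_succ hA j s) (fun j s hs => ?_)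
    (Metric.mem_ball_self hT) (by simpa only [picardTerm_succ_self] using summable_zero)
    (by simp [Real.dist_eq])
  have hs' : |s - t₀| ≤ |t - t₀| + 1 := by simpa [Real.dist_eq] using (Metric.mem_ball.1 hs).le
  exact ((A s).le_opNorm _).trans
    (mul_le_mul (hb s hs').1 ((hb s hs').2 j) (norm_nonneg _) hM)

theorem exists_linear_ode_solution [CompleteSpace E] (hA : Continuous A) (t₀ : ℝ) (x₀ : E) :
    ∃ x : ℝ → E, x t₀ = x₀ ∧ ∀ t, HasDerivAt x (A t (x t)) t := by
  refine ⟨fun t => x₀ + ∑' j, picardTerm A t₀ x₀ (j + 1) t, ?_, fun t => ?_⟩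
  · simp only [picardTerm_succ_self, tsum_zero, add_zero]
  · have hsum : ∑' j, picardTerm A t₀ x₀ j t = x₀ + ∑' j, picardTerm A t₀ x₀ (j + 1) t :=
      (summable_picardTerm hA t₀ x₀ t).tsum_eq_zero_add
    simpa only [hsum] using (hasDerivAt_tsum_picardTerm_succ hA t₀ x₀ t).const_add x₀

end Picard

/-- `f` is a solution of `f'' = q f` on the line, with derivative `f'`. -/
structure IsSol (q f f' : ℝ → ℝ) : Prop where
  deriv₁ : ∀ y, HasDerivAt f (f' y) y
  deriv₂ : ∀ y, HasDerivAt f' (q y * f y) y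

namespace IsSol

variable {q q₁ q₂ f f' g g' : ℝ → ℝ}

lemma continuous (h : IsSol q f f') : Continuous f :=
  continuous_iff_continuousAt.2 fun y => (h.deriv₁ y).continuousAt

lemma zero (q : ℝ → ℝ) : IsSol q (fun _ => 0) (fun _ => 0) :=
  ⟨fun y => hasDerivAt_const y 0, fun y => by simpa using hasDerivAt_const y (0 : ℝ)⟩

lemma const_mul (h : IsSol q f f') (c : ℝ) :
    IsSol q (fun y => c * f y) (fun y => c * f' y) :=
  ⟨fun y => (h.deriv₁ y).const_mul c, fun y =>
    ((h.deriv₂ y).const_mul c).congr_deriv (by ring)⟩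

lemma sub (h : IsSol q f f') (h' : IsSol q g g') :
    IsSol q (fun y => f y - g y) (fun y => f' y - g' y) :=
  ⟨fun y => (h.deriv₁ y).sub (h'.deriv₁ y), fun y =>
    ((h.deriv₂ y).sub (h'.deriv₂ y)).congr_deriv (by ring)⟩

lemma comp_neg (h : IsSol q f f') :
    IsSol (fun y => q (-y)) (fun y => f (-y)) (fun y => -f' (-y)) := by
  refine ⟨fun y => ?_, fun y => ?_⟩
  · exact ((h.deriv₁ (-y)).comp y (hasDerivAt_neg y)).congr_deriv (by ring)
  · exact ((h.deriv₂ (-y)).comp y (hasDerivAt_neg y)).neg.congr_deriv (by ring)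

lemma hasDerivAt_wronskian (h : IsSol q₁ f f') (h' : IsSol q₂ g g') (y : ℝ) :
    HasDerivAt (fun y => f y * g' y - f' y * g y) ((q₂ y - q₁ y) * (f y * g y)) y :=
  (((h.deriv₁ y).mul (h'.deriv₂ y)).sub ((h.deriv₂ y).mul (h'.deriv₁ y))).congr_deriv (by ring)

theorem exists_solution (hq : Continuous q) (t₀ α β : ℝ) :
    ∃ f f', IsSol q f f' ∧ f t₀ = α ∧ f' t₀ = β := by
  let A : ℝ → (ℝ × ℝ) →L[ℝ] ℝ × ℝ := fun t =>
    (ContinuousLinearMap.snd ℝ ℝ ℝ).prod (q t • ContinuousLinearMap.fst ℝ ℝ ℝ)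
  have hA : Continuous A := by
    have hsmul : Continuous fun t => q t • ContinuousLinearMap.fst ℝ ℝ ℝ := by fun_prop
    exact (ContinuousLinearMap.prodₗᵢ (E := ℝ × ℝ) (F := ℝ) (G := ℝ) (𝕜 := ℝ) ℝ).continuous.comp
      (continuous_const.prodMk hsmul)
  obtain ⟨x, hx0, hx⟩ := exists_linear_ode_solution hA t₀ (α, β)
  exact ⟨fun t => (x t).1, fun t => (x t).2, ⟨fun y => (hx y).fst, fun y => (hx y).snd⟩,
    by simp [hx0], by simp [hx0]⟩

end IsSol

lemma gronwallBound_le_mul_exp {δ M η t T : ℝ} (hδ : 0 ≤ δ) (hM : 0 ≤ M) (hη : 0 ≤ η)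
    (ht : 0 ≤ t) (htT : t ≤ T) :
    gronwallBound δ (M + 1) η t ≤ (δ + η) * Real.exp ((M + 1) * T) := by
  have hexp : Real.exp ((M + 1) * t) ≤ Real.exp ((M + 1) * T) := by gcongr
  have hexp_one : 0 ≤ Real.exp ((M + 1) * t) - 1 :=
    sub_nonneg.2 (Real.one_le_exp (by positivity))
  rw [gronwallBound_of_K_ne_0 (by positivity)]
  calc δ * Real.exp ((M + 1) * t) + η / (M + 1) * (Real.exp ((M + 1) * t) - 1)
      ≤ δ * Real.exp ((M + 1) * T) + η * Real.exp ((M + 1) * T) := by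
        gcongr
        · exact div_le_self hη (by linarith)
        · linarith
    _ = (δ + η) * Real.exp ((M + 1) * T) := by ring

lemma norm_pair_deriv_le {q₁ q₂ u u' v v' M η : ℝ} (hM : |q₁| ≤ M) (hη : |q₁ - q₂| * |v| ≤ η) :
    ‖(u' - v', q₁ * u - q₂ * v)‖ ≤ (M + 1) * ‖(u - v, u' - v')‖ + η := by
  have hfst : |u - v| ≤ ‖(u - v, u' - v')‖ := norm_fst_le (u - v, u' - v')
  have hsnd : |u' - v'| ≤ ‖(u - v, u' - v')‖ := norm_snd_le (u - v, u' - v')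
  have hM0 : 0 ≤ M := (abs_nonneg _).trans hM
  have hη0 : 0 ≤ η := (by positivity : 0 ≤ |q₁ - q₂| * |v|).trans hη
  refine max_le ?_ ?_ <;> simp only [Real.norm_eq_abs]
  · nlinarith [norm_nonneg (u - v, u' - v')]
  · calc |q₁ * u - q₂ * v| = |q₁ * (u - v) + (q₁ - q₂) * v| := by ring_nf
      _ ≤ |q₁| * |u - v| + |q₁ - q₂| * |v| := by
          rw [← abs_mul, ← abs_mul]; exact abs_add_le _ _
      _ ≤ M * ‖(u - v, u' - v')‖ + η := by gcongr
      _ ≤ (M + 1) * ‖(u - v, u' - v')‖ + η := by linarith [norm_nonneg (u - v, u' - v')]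

namespace IsSol

variable {q q₁ q₂ f f' g g' : ℝ → ℝ}

theorem gronwall {a b M η δ : ℝ} (h₁ : IsSol q₁ f f') (h₂ : IsSol q₂ g g')
    (hM : ∀ x ∈ Icc a b, |q₁ x| ≤ M) (hη : ∀ x ∈ Icc a b, |q₁ x - q₂ x| * |g x| ≤ η)
    (hδ : |f a - g a| ≤ δ) (hδ' : |f' a - g' a| ≤ δ) {x : ℝ} (hx : x ∈ Icc a b) :
    |f x - g x| ≤ (δ + η) * Real.exp ((M + 1) * (b - a)) ∧
      |f' x - g' x| ≤ (δ + η) * Real.exp ((M + 1) * (b - a)) := by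
  have hderiv : ∀ t, HasDerivAt (fun t => (f t - g t, f' t - g' t))
      (f' t - g' t, q₁ t * f t - q₂ t * g t) t := fun t =>
    ((h₁.deriv₁ t).sub (h₂.deriv₁ t)).prodMk ((h₁.deriv₂ t).sub (h₂.deriv₂ t))
  have hnorm : ‖(f x - g x, f' x - g' x)‖ ≤ gronwallBound δ (M + 1) η (x - a) :=
    norm_le_gronwallBound_of_norm_deriv_right_le
      (continuous_iff_continuousAt.2 fun t => (hderiv t).continuousAt).continuousOn
      (fun t _ => (hderiv t).hasDerivWithinAt) (max_le hδ hδ')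
      (fun t ht => norm_pair_deriv_le (hM t ⟨ht.1, ht.2.le⟩) (hη t ⟨ht.1, ht.2.le⟩)) x hx
  have hbound : gronwallBound δ (M + 1) η (x - a) ≤ (δ + η) * Real.exp ((M + 1) * (b - a)) :=
    gronwallBound_le_mul_exp ((abs_nonneg _).trans hδ) ((abs_nonneg _).trans (hM x hx))
      ((by positivity : 0 ≤ |q₁ x - q₂ x| * |g x|).trans (hη x hx)) (sub_nonneg.2 hx.1)
      (sub_le_sub_right hx.2 a)
  exact ⟨(norm_fst_le (f x - g x, f' x - g' x)).trans (hnorm.trans hbound),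
    (norm_snd_le (f x - g x, f' x - g' x)).trans (hnorm.trans hbound)⟩

lemma eq_zero_of_le (hq : Continuous q) (h : IsSol q f f') {a y : ℝ} (h0 : f a = 0)
    (h0' : f' a = 0) (hy : a ≤ y) : f y = 0 := by
  obtain ⟨M, hM⟩ := (isCompact_Icc (a := a) (b := y)).exists_bound_of_continuousOn
    hq.continuousOn
  have := (h.gronwall (zero q) (δ := 0) (η := 0) hM (by simp) (by simp [h0]) (by simp [h0'])
    (right_mem_Icc.2 hy)).1
  simpa using this

theorem eq_zero (hq : Continuous q) (h : IsSol q f f') {a : ℝ} (h0 : f a = 0)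
    (h0' : f' a = 0) (y : ℝ) : f y = 0 := by
  rcases le_total a y with hy | hy
  · exact h.eq_zero_of_le hq h0 h0' hy
  · simpa using h.comp_neg.eq_zero_of_le (hq.comp continuous_neg) (a := -a) (by simpa)
      (by simpa) (neg_le_neg hy)

theorem eq_div_mul_of_wronskian_eq_zero (hq : Continuous q) (h : IsSol q f f')
    (h' : IsSol q g g') {a : ℝ} (hg : g a ≠ 0) (hW : f a * g' a - f' a * g a = 0) (y : ℝ) :
    f y = f a / g a * g y := by
  have := eq_zero hq (h.sub (h'.const_mul (f a / g a))) (a := a) (by field_simp; ring)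
    (by field_simp; linarith) y
  linarith

end IsSol

/-! ### Decaying solutions on a half-line -/

lemma monotoneOn_Ici_of_hasDerivAt_nonneg {g g' : ℝ → ℝ} {a : ℝ}
    (hd : ∀ y, HasDerivAt g (g' y) y) (h : ∀ y, a ≤ y → 0 ≤ g' y) : MonotoneOn g (Ici a) := by
  refine monotoneOn_of_deriv_nonneg (convex_Ici a)
    (fun y _ => (hd y).continuousAt.continuousWithinAt)
    (fun y _ => (hd y).differentiableAt.differentiableWithinAt) fun y hy => ?_
  rw [(hd y).deriv]
  exact h y (interior_subset hy)

lemma integrableOn_Ioi_deriv_of_nonneg_of_le {g g' : ℝ → ℝ} {a C : ℝ}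
    (hd : ∀ y, HasDerivAt g (g' y) y) (h : ∀ y, a ≤ y → 0 ≤ g' y)
    (hC : ∀ y, a ≤ y → g y ≤ C) : IntegrableOn g' (Ioi a) := by
  have hm := monotoneOn_Ici_of_hasDerivAt_nonneg hd h
  have hmono : Monotone fun y => g (max a y) := fun x y hxy =>
    hm (mem_Ici.2 (le_max_left _ _)) (mem_Ici.2 (le_max_left _ _)) (max_le_max le_rfl hxy)
  have hlim := tendsto_atTop_ciSup hmono
    ⟨C, by rintro _ ⟨y, rfl⟩; exact hC _ (le_max_left _ _)⟩
  refine integrableOn_Ioi_deriv_of_nonneg' (l := ⨆ y, g (max a y)) (fun y _ => hd y)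
    (fun y hy => h y (le_of_lt hy)) (hlim.congr' ?_)
  filter_upwards [eventually_ge_atTop a] with y hy
  rw [max_eq_right hy]

lemma not_integrableOn_Ioi_of_le {g : ℝ → ℝ} {a b η : ℝ} (hη : 0 < η)
    (h : ∀ y, b ≤ y → η ≤ g y) : ¬ IntegrableOn g (Ioi a) := by
  intro hi
  have hconst : IntegrableOn (fun _ : ℝ => η) (Ioi (max a b)) := by
    refine Integrable.mono' (hi.mono_set (Ioi_subset_Ioi (le_max_left a b)))
      aestronglyMeasurable_const ?_
    filter_upwards [ae_restrict_mem measurableSet_Ioi] with y hy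
    rw [Real.norm_of_nonneg hη.le]
    exact h y ((le_max_right a b).trans (le_of_lt hy))
  rw [integrableOn_const_iff] at hconst
  simp [hη.ne'] at hconst

namespace IsSol

variable {q f f' g g' : ℝ → ℝ} {a y : ℝ}

lemma monotoneOn_mul_deriv (h : IsSol q f f') (hq : ∀ y, a ≤ y → 0 ≤ q y) :
    MonotoneOn (fun y => f y * f' y) (Ici a) :=
  monotoneOn_Ici_of_hasDerivAt_nonneg (fun y => (h.deriv₁ y).mul (h.deriv₂ y)) fun y hy => by
    nlinarith [mul_self_nonneg (f' y), mul_nonneg (hq y hy) (mul_self_nonneg (f y))]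

lemma monotoneOn_sq (h : IsSol q f f') (hq : ∀ y, a ≤ y → 0 ≤ q y)
    (h0 : 0 ≤ f a * f' a) : MonotoneOn (fun y => f y ^ 2) (Ici a) :=
  monotoneOn_Ici_of_hasDerivAt_nonneg (fun y => (h.deriv₁ y).pow 2) fun y hy => by
    have : f a * f' a ≤ f y * f' y := h.monotoneOn_mul_deriv hq self_mem_Ici hy hy
    norm_num
    linarith

lemma pos_of_pos (h : IsSol q f f') (hq : ∀ y, a ≤ y → 0 ≤ q y) (h0 : 0 < f a)
    (h0' : 0 ≤ f' a) (hy : a ≤ y) : 0 < f y := by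
  by_contra! hle
  obtain ⟨x, hx, hx0⟩ := intermediate_value_Icc' hy h.continuous.continuousOn ⟨hle, h0.le⟩
  have : f a ^ 2 ≤ f x ^ 2 := h.monotoneOn_sq hq (by positivity) self_mem_Ici hx.1 hx.1
  rw [hx0] at this
  nlinarith

lemma wronskian_eq (h : IsSol q f f') (h' : IsSol q g g') (x y : ℝ) :
    f x * g' x - f' x * g x = f y * g' y - f' y * g y := by
  have hd : ∀ y, HasDerivAt (fun y => f y * g' y - f' y * g y) 0 y := fun y =>
    (h.hasDerivAt_wronskian h' y).congr_deriv (by ring)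
  exact is_const_of_deriv_eq_zero (fun y => (hd y).differentiableAt) (fun y => (hd y).deriv) x y

lemma strictAntiOn_div (h : IsSol q f f') (h' : IsSol q g g') (hg : ∀ y, a ≤ y → 0 < g y)
    (hW : 0 < f a * g' a - f' a * g a) : StrictAntiOn (fun y => f y / g y) (Ici a) := by
  have hd : ∀ y ∈ Ici a, HasDerivAt (fun y => f y / g y)
      ((f' y * g y - f y * g' y) / g y ^ 2) y := fun y hy =>
    (h.deriv₁ y).div (h'.deriv₁ y) (hg y hy).ne'
  refine strictAntiOn_of_deriv_neg (convex_Ici a)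
    (fun y hy => (hd y hy).continuousAt.continuousWithinAt) fun y hy => ?_
  have hy' : a ≤ y := interior_subset hy
  rw [(hd y hy').deriv]
  exact div_neg_of_neg_of_pos (by linarith [h.wronskian_eq h' y a]) (pow_pos (hg y hy') 2)

lemma exists_mul_lt (h : IsSol q f f') (h' : IsSol q g g') (hq : ∀ y, a ≤ y → 0 ≤ q y)
    (h0 : 0 < f a) (h0' : 0 < f' a) : ∃ κ > 0, ∀ y, a ≤ y → κ * g y < f y := by
  obtain ⟨κ, hκ, hlt⟩ := exists_pos_mul_lt (lt_min h0 h0') (max (g a) (g' a))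
  have hga : g a * κ ≤ max (g a) (g' a) * κ := by gcongr; exact le_max_left _ _
  have hga' : g' a * κ ≤ max (g a) (g' a) * κ := by gcongr; exact le_max_right _ _
  have hmin : min (f a) (f' a) ≤ f a := min_le_left _ _
  have hmin' : min (f a) (f' a) ≤ f' a := min_le_right _ _
  refine ⟨κ, hκ, fun y hy => sub_pos.1 ?_⟩
  exact (h.sub (h'.const_mul κ)).pos_of_pos hq (by linarith) (by linarith) hy

/-- The solution is `ψ - s χ` with `ψ`, `χ` growing and `s = inf ψ / χ`: were it increasing
somewhere, it would dominate a multiple of `χ`, and `s` could be increased. -/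
theorem exists_pos_antitone (hq : Continuous q) (hq0 : ∀ y, a ≤ y → 0 ≤ q y) :
    ∃ f f', IsSol q f f' ∧ ∀ y, a ≤ y → 0 < f y ∧ f' y ≤ 0 := by
  obtain ⟨ψ, ψ', hψ, hψa, hψa'⟩ := exists_solution hq a 1 0
  obtain ⟨χ, χ', hχ, hχa, hχa'⟩ := exists_solution hq a 1 1
  have ψ_pos : ∀ y, a ≤ y → 0 < ψ y := fun y hy =>
    hψ.pos_of_pos hq0 (by simp [hψa]) (by simp [hψa']) hy
  have χ_pos : ∀ y, a ≤ y → 0 < χ y := fun y hy =>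
    hχ.pos_of_pos hq0 (by simp [hχa]) (by simp [hχa']) hy
  have div_anti := hψ.strictAntiOn_div hχ χ_pos (by simp [hψa, hψa', hχa, hχa'])
  set s := sInf ((fun y => ψ y / χ y) '' Ici a)
  have hbdd : BddBelow ((fun y => ψ y / χ y) '' Ici a) :=
    ⟨0, by rintro _ ⟨y, hy, rfl⟩; exact (div_pos (ψ_pos y hy) (χ_pos y hy)).le⟩
  have s_lt : ∀ y, a ≤ y → s < ψ y / χ y := fun y hy => by
    have hy1 : a ≤ y + 1 := by linarith
    exact (csInf_le hbdd ⟨y + 1, hy1, rfl⟩).trans_lt (div_anti hy hy1 (by linarith))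
  have hφ := hψ.sub (hχ.const_mul s)
  have φ_pos : ∀ y, a ≤ y → 0 < ψ y - s * χ y := fun y hy =>
    sub_pos.2 ((lt_div_iff₀ (χ_pos y hy)).1 (s_lt y hy))
  refine ⟨_, _, hφ, fun b hb => ⟨φ_pos b hb, ?_⟩⟩
  by_contra! hφ'
  obtain ⟨κ, hκ, hlt⟩ := hφ.exists_mul_lt hχ (fun y hy => hq0 y (hb.trans hy)) (φ_pos b hb) hφ'
  have hge : ∀ y, b ≤ y → s + κ ≤ ψ y / χ y := fun y hy => by
    rw [le_div_iff₀ (χ_pos y (hb.trans hy))]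
    linarith [hlt y hy]
  have : s + κ ≤ s := by
    refine le_csInf ⟨_, a, self_mem_Ici, rfl⟩ ?_
    rintro _ ⟨y, hy, rfl⟩
    rcases le_total b y with hby | hyb
    · exact hge y hby
    · exact (hge b le_rfl).trans (div_anti.antitoneOn hy hb hyb)
  linarith

end IsSol

/-- `f` is a solution of `f'' = q f` which is positive, integrable and bounded by `f R` on
`[R, ∞)` and tends to `0` at infinity together with its derivative. Only the behaviour on
`[R, ∞)` is restricted, although the solution is defined on the line. -/
structure IsDecaying (q : ℝ → ℝ) (R : ℝ) (f f' : ℝ → ℝ) : Prop extends IsSol q f f' where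
  pos : ∀ y, R ≤ y → 0 < f y
  le : ∀ y, R ≤ y → f y ≤ f R
  integrableOn : IntegrableOn f (Ioi R)
  tendsto : Tendsto f atTop (𝓝 0)
  tendsto' : Tendsto f' atTop (𝓝 0)

namespace IsDecaying

variable {q q₁ q₂ f f' g g' : ℝ → ℝ} {R c : ℝ}

lemma const_mul (h : IsDecaying q R f f') (hc : 0 < c) :
    IsDecaying q R (fun y => c * f y) (fun y => c * f' y) where
  toIsSol := h.toIsSol.const_mul c
  pos y hy := mul_pos hc (h.pos y hy)
  le y hy := mul_le_mul_of_nonneg_left (h.le y hy) hc.le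
  integrableOn := h.integrableOn.const_mul c
  tendsto := by simpa using h.tendsto.const_mul c
  tendsto' := by simpa using h.tendsto'.const_mul c

lemma of_pos_of_deriv_nonpos (h : IsSol q f f') (hc : 0 < c) (hqc : ∀ y, R ≤ y → c ≤ q y)
    (hf : ∀ y, R ≤ y → 0 < f y ∧ f' y ≤ 0) : IsDecaying q R f f' := by
  have deriv_int : IntegrableOn f' (Ioi R) := by
    have := integrableOn_Ioi_deriv_of_nonneg_of_le (C := 0) (fun y => (h.deriv₁ y).neg)
      (fun y hy => by linarith [(hf y hy).2]) (fun y hy => by simpa using (hf y hy).1.le)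
    simpa using this.neg
  have mul_int : IntegrableOn (fun y => q y * f y) (Ioi R) :=
    integrableOn_Ioi_deriv_of_nonneg_of_le (C := 0) h.deriv₂
      (fun y hy => mul_nonneg (hc.le.trans (hqc y hy)) (hf y hy).1.le) fun y hy => (hf y hy).2
  have f_int : IntegrableOn f (Ioi R) := by
    refine Integrable.mono' (mul_int.const_mul c⁻¹) h.continuous.aestronglyMeasurable ?_
    filter_upwards [ae_restrict_mem measurableSet_Ioi] with y hy
    have hy' : R ≤ y := le_of_lt hy
    rw [Real.norm_of_nonneg (hf y hy').1.le, inv_mul_eq_div, le_div_iff₀ hc, mul_comm]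
    exact mul_le_mul_of_nonneg_right (hqc y hy') (hf y hy').1.le
  refine ⟨h, fun y hy => (hf y hy).1, fun y hy => ?_, f_int,
    tendsto_zero_of_hasDerivAt_of_integrableOn_Ioi (fun y _ => h.deriv₁ y) deriv_int f_int,
    tendsto_zero_of_hasDerivAt_of_integrableOn_Ioi (fun y _ => h.deriv₂ y) mul_int deriv_int⟩
  simpa using monotoneOn_Ici_of_hasDerivAt_nonneg (a := R) (fun y => (h.deriv₁ y).neg)
    (fun y hy => by linarith [(hf y hy).2]) self_mem_Ici hy hy

theorem exists_isDecaying (hq : Continuous q) (hc : 0 < c) (hqc : ∀ y, R ≤ y → c ≤ q y)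
    {α : ℝ} (hα : 0 < α) : ∃ f f', IsDecaying q R f f' ∧ f R = α := by
  obtain ⟨φ, φ', hφ, hanti⟩ := IsSol.exists_pos_antitone hq fun y hy => hc.le.trans (hqc y hy)
  have hφR := (hanti R le_rfl).1
  exact ⟨_, _, (of_pos_of_deriv_nonpos hφ hc hqc hanti).const_mul (div_pos hα hφR), by field_simp⟩

lemma integrableOn_sq (h : IsDecaying q R f f') : IntegrableOn (fun y => f y ^ 2) (Ioi R) := by
  refine Integrable.mono' (h.integrableOn.const_mul (f R))
    (h.continuous.pow 2).aestronglyMeasurable ?_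
  filter_upwards [ae_restrict_mem measurableSet_Ioi] with y hy
  have hy' : R ≤ y := le_of_lt hy
  rw [Real.norm_of_nonneg (by positivity), sq]
  exact mul_le_mul_of_nonneg_right (h.le y hy') (h.pos y hy').le

theorem eq_div_mul (hq : Continuous q) (hq0 : ∀ y, R ≤ y → 0 ≤ q y)
    (hf : IsDecaying q R f f') (hg : IsSol q g g')
    (hi : IntegrableOn (fun y => g y ^ 2) (Ioi R)) (y : ℝ) : g y = g R / f R * f y := by
  set κ := g R / f R
  have hv := hg.sub (hf.toIsSol.const_mul κ)
  have hfR := hf.pos R le_rfl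
  have hvR : g R - κ * f R = 0 := by simp only [κ]; field_simp; ring
  have v_sq_mono := hv.monotoneOn_sq hq0 (by simp [hvR])
  have v_sq_int : IntegrableOn (fun y => (g y - κ * f y) ^ 2) (Ioi R) := by
    refine Integrable.mono' ((hi.const_mul 2).add (hf.integrableOn_sq.const_mul (2 * κ ^ 2)))
      (hv.continuous.pow 2).aestronglyMeasurable (Eventually.of_forall fun y => ?_)
    rw [Real.norm_of_nonneg (sq_nonneg _)]
    simp only [Pi.add_apply]
    nlinarith [sq_nonneg (g y + κ * f y)]
  have v_zero : ∀ y, R ≤ y → g y - κ * f y = 0 := fun y hy => by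
    by_contra hne
    exact not_integrableOn_Ioi_of_le (sq_pos_of_ne_zero hne)
      (fun z hz => v_sq_mono hy (hy.trans hz) hz) v_sq_int
  have v_zero' : g' (R + 1) - κ * f' (R + 1) = 0 := by
    refine (hv.deriv₁ (R + 1)).unique ((hasDerivAt_const (R + 1) (0 : ℝ)).congr_of_eventuallyEq ?_)
    filter_upwards [eventually_gt_nhds (show R < R + 1 by linarith)] with z hz
    exact v_zero z hz.le
  exact sub_eq_zero.1 (hv.eq_zero hq (v_zero (R + 1) (by linarith)) v_zero' y)

theorem of_integrableOn_sq (hq : Continuous q) (hc : 0 < c) (hqc : ∀ y, R ≤ y → c ≤ q y)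
    (hg : IsSol q g g') (hi : IntegrableOn (fun y => g y ^ 2) (Ioi R)) (hR : 0 < g R) :
    IsDecaying q R g g' := by
  obtain ⟨f, f', hf, hfR⟩ := exists_isDecaying hq hc hqc hR
  have hgf : g = f := funext fun y => by
    rw [eq_div_mul hq (fun y hy => hc.le.trans (hqc y hy)) hf hg hi y, hfR, div_self hR.ne',
      one_mul]
  have hgf' : g' = f' := funext fun y => (hg.deriv₁ y).unique (hgf ▸ hf.deriv₁ y)
  rwa [hgf, hgf']

theorem abs_deriv_sub_le (hq₁ : Continuous q₁) (hq₂ : Continuous q₂)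
    (hf : IsDecaying q₁ R f f') (hg : IsDecaying q₂ R g g') (hR : f R = g R)
    (hi : IntegrableOn (fun y => |q₁ y - q₂ y| * g y) (Ioi R)) :
    |f' R - g' R| ≤ ∫ y in Ioi R, |q₁ y - q₂ y| * g y := by
  have hfR := hf.pos R le_rfl
  have norm_le : ∀ y ∈ Ioi R, ‖(q₂ y - q₁ y) * (f y * g y)‖ ≤ f R * (|q₁ y - q₂ y| * g y) :=
    fun y hy => by
      have hy' : R ≤ y := le_of_lt hy
      have hgy := (hg.pos y hy').le
      rw [norm_mul, norm_mul, Real.norm_of_nonneg (hf.pos y hy').le, Real.norm_of_nonneg hgy,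
        Real.norm_eq_abs, abs_sub_comm]
      calc |q₁ y - q₂ y| * (f y * g y) = f y * (|q₁ y - q₂ y| * g y) := by ring
        _ ≤ _ := by gcongr; exact hf.le y hy'
  have hint : IntegrableOn (fun y => (q₂ y - q₁ y) * (f y * g y)) (Ioi R) :=
    Integrable.mono' (hi.const_mul (f R))
      ((hq₂.sub hq₁).mul (hf.continuous.mul hg.continuous)).aestronglyMeasurable
      ((ae_restrict_iff' measurableSet_Ioi).2 (Eventually.of_forall norm_le))
  have wronskian_lim : Tendsto (fun y => f y * g' y - f' y * g y) atTop (𝓝 0) := by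
    simpa using (hf.tendsto.mul hg.tendsto').sub (hf.tendsto'.mul hg.tendsto)
  have wronskian_eq : ∫ y in Ioi R, (q₂ y - q₁ y) * (f y * g y) = f R * (f' R - g' R) := by
    rw [integral_Ioi_of_hasDerivAt_of_tendsto'
      (fun y _ => hf.hasDerivAt_wronskian hg.toIsSol y) hint wronskian_lim, ← hR]
    ring
  refine le_of_mul_le_mul_left ?_ hfR
  calc f R * |f' R - g' R| = ‖∫ y in Ioi R, (q₂ y - q₁ y) * (f y * g y)‖ := by
        rw [wronskian_eq, Real.norm_eq_abs, abs_mul, abs_of_pos hfR]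
    _ ≤ ∫ y in Ioi R, f R * (|q₁ y - q₂ y| * g y) :=
        (norm_integral_le_integral_norm _).trans
          (setIntegral_mono_on hint.norm (hi.const_mul _) measurableSet_Ioi norm_le)
    _ = f R * ∫ y in Ioi R, |q₁ y - q₂ y| * g y := integral_const_mul _ _

theorem abs_sub_le {M η y : ℝ} (hq₁ : Continuous q₁)
    (hq₂ : Continuous q₂) (hf : IsDecaying q₁ R f f') (hg : IsDecaying q₂ R g g')
    (hR : f R = g R) (hi : IntegrableOn (fun y => |q₁ y - q₂ y| * g y) (Ioi R))
    (hint : ∫ y in Ioi R, |q₁ y - q₂ y| * g y ≤ η)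
    (hM : ∀ y ∈ Icc (-R) R, |q₁ y| ≤ M) (hη : ∀ y ∈ Icc (-R) R, |q₁ y - q₂ y| * |g y| ≤ η)
    (hy : y ∈ Icc (-R) R) :
    |f y - g y| ≤ 2 * η * Real.exp ((M + 1) * (2 * R)) ∧
      |f' y - g' y| ≤ 2 * η * Real.exp ((M + 1) * (2 * R)) := by
  have neg_mem : ∀ y ∈ Icc (-R) R, -y ∈ Icc (-R) R := fun y hy =>
    ⟨neg_le_neg hy.2, by linarith [hy.1]⟩
  have hη0 : 0 ≤ η := (by positivity : 0 ≤ |q₁ y - q₂ y| * |g y|).trans (hη y hy)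
  have deriv_le := (abs_deriv_sub_le hq₁ hq₂ hf hg hR hi).trans hint
  have hgron := hf.comp_neg.gronwall hg.comp_neg (a := -R) (b := R) (M := M) (η := η) (δ := η)
    (fun y hy => hM _ (neg_mem y hy)) (fun y hy => hη _ (neg_mem y hy)) (by simpa [hR] using hη0)
    (by rw [neg_neg, neg_sub_neg, abs_sub_comm]; exact deriv_le) (neg_mem y hy)
  simp only [neg_neg, neg_sub_neg] at hgron
  rw [sub_neg_eq_add, ← two_mul, ← two_mul] at hgron
  exact ⟨hgron.1, by rw [abs_sub_comm]; exact hgron.2⟩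

lemma integral_abs_sub_mul_le {D : ℝ → ℝ} {δ : ℝ} (hq₁ : Continuous q₁) (hq₂ : Continuous q₂)
    (hg : IsDecaying q₂ R g g') (hDg : IntegrableOn (fun y => D y * g y) (Ioi R))
    (hD : ∀ y ∈ Ioi R, |q₁ y - q₂ y| ≤ δ * D y) :
    IntegrableOn (fun y => |q₁ y - q₂ y| * g y) (Ioi R) ∧
      ∫ y in Ioi R, |q₁ y - q₂ y| * g y ≤ δ * ∫ y in Ioi R, D y * g y := by
  have g_nonneg : ∀ y ∈ Ioi R, 0 ≤ g y := fun y hy => (hg.pos y (le_of_lt hy)).le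
  have hle : ∀ y ∈ Ioi R, |q₁ y - q₂ y| * g y ≤ δ * (D y * g y) := fun y hy => by
    rw [← mul_assoc]; exact mul_le_mul_of_nonneg_right (hD y hy) (g_nonneg y hy)
  have hint : IntegrableOn (fun y => |q₁ y - q₂ y| * g y) (Ioi R) := by
    refine Integrable.mono' (hDg.const_mul δ)
      ((hq₁.sub hq₂).abs.mul hg.continuous).aestronglyMeasurable ?_
    filter_upwards [ae_restrict_mem measurableSet_Ioi] with y hy
    rw [Real.norm_of_nonneg (mul_nonneg (abs_nonneg _) (g_nonneg y hy))]
    exact hle y hy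
  rw [← integral_const_mul]
  exact ⟨hint, setIntegral_mono_on hint (hDg.const_mul δ) measurableSet_Ioi hle⟩

theorem exists_close_bound {q₀ h h' D : ℝ → ℝ} (hR : 0 < R) (hq₀ : Continuous q₀)
    (hh : IsDecaying q₀ R h h') (hD : Continuous D) (hD0 : ∀ y, 0 ≤ D y)
    (hDh : IntegrableOn (fun y => D y * h y) (Ioi R)) (Δ : ℝ) :
    ∃ C ≥ 0, ∀ q, Continuous q → ∀ δ ≤ Δ, 0 ≤ δ → (∀ y, |q y - q₀ y| ≤ δ * D y) →
      ∀ f f', IsDecaying q R f f' → f R = h R → ∀ y ∈ Icc (-R) R,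
        |f y - h y| ≤ C * δ ∧ |f' y - h' y| ≤ C * δ := by
  have hRmem : R ∈ Icc (-R) R := ⟨by linarith, le_rfl⟩
  obtain ⟨B, hB⟩ := (isCompact_Icc (a := -R) (b := R)).exists_bound_of_continuousOn
    hh.continuous.continuousOn
  obtain ⟨M, hM⟩ := (isCompact_Icc (a := -R) (b := R)).exists_bound_of_continuousOn
    hq₀.continuousOn
  obtain ⟨L, hL⟩ := (isCompact_Icc (a := -R) (b := R)).exists_bound_of_continuousOn
    hD.continuousOn
  have hB0 : 0 ≤ B := (norm_nonneg _).trans (hB R hRmem)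
  have hL0 : 0 ≤ L := (norm_nonneg _).trans (hL R hRmem)
  set I := ∫ y in Ioi R, D y * h y
  have hI : 0 ≤ I := setIntegral_nonneg measurableSet_Ioi fun y hy =>
    mul_nonneg (hD0 y) (hh.pos y (le_of_lt hy)).le
  refine ⟨2 * (I + L * B) * Real.exp ((M + Δ * L + 1) * (2 * R)), by positivity,
    fun q hq δ hδΔ hδ hqD f f' hf hfR y hy => ?_⟩
  have D_le : ∀ y ∈ Icc (-R) R, D y ≤ L := fun y hy => (le_abs_self _).trans (hL y hy)
  obtain ⟨pot_int, integral_le⟩ := integral_abs_sub_mul_le hq hq₀ hh hDh fun y _ => hqD y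
  have habs := abs_sub_le (M := M + Δ * L) (η := δ * (I + L * B)) hq hq₀ hf hh hfR pot_int
    (integral_le.trans (by gcongr; exact le_add_of_nonneg_right (by positivity)))
    (fun y hy => ?_) (fun y hy => ?_) hy
  · exact ⟨habs.1.trans_eq (by ring), habs.2.trans_eq (by ring)⟩
  · calc |q y| = |q₀ y + (q y - q₀ y)| := by ring_nf
      _ ≤ |q₀ y| + |q y - q₀ y| := abs_add_le _ _
      _ ≤ M + Δ * L := add_le_add (hM y hy)
          ((hqD y).trans (mul_le_mul hδΔ (D_le y hy) (hD0 y) (hδ.trans hδΔ)))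
  · calc |q y - q₀ y| * |h y| ≤ δ * L * B := by
          gcongr
          · exact (hqD y).trans (by gcongr; exact D_le y hy)
          · exact hB y hy
      _ ≤ δ * (I + L * B) := by rw [mul_assoc]; gcongr; exact le_add_of_nonneg_left hI

end IsDecaying

lemma continuousOn_of_locally_lipschitz {φ : ℝ → ℝ} {s : Set ℝ} {r : ℝ} (hr : 0 < r)
    (h : ∀ x ∈ s, ∃ K, ∀ y ∈ s, |y - x| ≤ r → |φ y - φ x| ≤ K * |y - x|) :
    ContinuousOn φ s := by
  intro x hx
  obtain ⟨K, hK⟩ := h x hx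
  rw [ContinuousWithinAt, tendsto_iff_norm_sub_tendsto_zero]
  have hlim : Tendsto (fun y => K * |y - x|) (𝓝[s] x) (𝓝 0) := by
    have : Continuous fun y => K * |y - x| := by fun_prop
    simpa using (this.tendsto x).mono_left nhdsWithin_le_nhds
  refine squeeze_zero' (Eventually.of_forall fun y => norm_nonneg _) ?_ hlim
  filter_upwards [self_mem_nhdsWithin,
    mem_nhdsWithin_of_mem_nhds (Metric.closedBall_mem_nhds x hr)] with y hy hyx
  exact hK y hy (by rwa [Metric.mem_closedBall, Real.dist_eq] at hyx)

theorem IsDecaying.continuousOn_family {q : ℝ → ℝ} {F F' : ℝ → ℝ → ℝ} {s : Set ℝ} {R α y : ℝ}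
    (hR : 0 < R) (hq : Continuous q)
    (hF : ∀ μ ∈ s, IsDecaying (fun y => q y - μ) R (F μ) (F' μ)) (hα : ∀ μ ∈ s, F μ R = α)
    (hy : y ∈ Icc (-R) R) :
    ContinuousOn (fun μ => F μ y) s ∧ ContinuousOn (fun μ => F' μ y) s := by
  have hlip : ∀ ν ∈ s, ∃ K, ∀ μ ∈ s, |μ - ν| ≤ 1 →
      |F μ y - F ν y| ≤ K * |μ - ν| ∧ |F' μ y - F' ν y| ≤ K * |μ - ν| := by
    intro ν hν
    obtain ⟨K, -, hK⟩ := exists_close_bound hR (hq.sub continuous_const) (hF ν hν)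
      (continuous_const (y := (1 : ℝ))) (fun _ => zero_le_one)
      (by simpa using (hF ν hν).integrableOn) 1
    refine ⟨K, fun μ hμ hμν => hK _ (hq.sub continuous_const) _ hμν (abs_nonneg _)
      (fun y => ?_) _ _ (hF μ hμ) ((hα μ hμ).trans (hα ν hν).symm) y hy⟩
    simp only [Pi.sub_apply, sub_sub_sub_cancel_left, abs_sub_comm, mul_one, le_refl]
  constructor <;> refine continuousOn_of_locally_lipschitz one_pos fun ν hν => ?_ <;>
    obtain ⟨K, hK⟩ := hlip ν hν
  · exact ⟨K, fun μ hμ hμν => (hK μ hμ hμν).1⟩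
  · exact ⟨K, fun μ hμ hμν => (hK μ hμ hμν).2⟩

/-! ### Eigenvalues by two-sided shooting -/

/-- `μ` is an eigenvalue of `-d²/dy² + q` on `L²(ℝ)`, with a real classical eigenfunction. -/
def IsL2Eigenvalue (q : ℝ → ℝ) (μ : ℝ) : Prop :=
  ∃ φ φ', IsSol (fun y => q y - μ) φ φ' ∧ Integrable (fun y => φ y ^ 2) ∧ φ ≠ 0

/-- `f` is a decaying solution on `[R, ∞)`, and so is its reflection `y ↦ σ f(-y)`. -/
structure IsBiDecaying (q : ℝ → ℝ) (σ R : ℝ) (f f' : ℝ → ℝ) : Prop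
    extends IsDecaying q R f f' where
  left : IsDecaying (fun y => q (-y)) R (fun y => σ * f (-y)) (fun y => σ * -f' (-y))

/-- A reference function `h` of parity `σ = ±1`, positive on `[R, ∞)`. The constants record that
a product of two continuous functions `κ`-close to `h` on `[-R, R]` has integral at least `S`
there, and that such functions are bounded by `B`. -/
structure IsReference (h : ℝ → ℝ) (σ R κ S B : ℝ) : Prop where
  continuous : Continuous h
  integrable : Integrable h
  sign_mul_self : σ * σ = 1
  sign_mul_map_neg : ∀ y, σ * h (-y) = h y
  R_pos : 0 < R
  pos : ∀ y, R ≤ y → 0 < h y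
  κ_le : κ ≤ h R / 2
  S_pos : 0 < S
  le_integral : ∀ f g : ℝ → ℝ, Continuous f → Continuous g →
    (∀ y ∈ Icc (-R) R, |f y - h y| ≤ κ) → (∀ y ∈ Icc (-R) R, |g y - h y| ≤ κ) →
    S ≤ ∫ y in Ioc (-R) R, f y * g y
  abs_add_κ_le : ∀ y ∈ Icc (-R) R, |h y| + κ ≤ B

/-- For `|μ| ≤ θ` the potential `q - μ` is bounded below by a positive constant on `[R, ∞)`, and
its decaying solutions with the value of `h` at `R` are `κ`-close to `h` on `[-R, R]`. -/
structure Tracks (q h : ℝ → ℝ) (R κ θ : ℝ) : Prop where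
  continuous : Continuous q
  exists_pos_le : ∃ c > 0, ∀ μ y, |μ| ≤ θ → R ≤ y → c ≤ q y - μ
  close : ∀ μ f f', |μ| ≤ θ → IsDecaying (fun y => q y - μ) R f f' → f R = h R →
    ∀ y ∈ Icc (-R) R, |f y - h y| ≤ κ

lemma integrable_of_integrableOn_tails {f : ℝ → ℝ} {R : ℝ} (hf : Continuous f)
    (hright : IntegrableOn f (Ioi R)) (hleft : IntegrableOn (fun y => f (-y)) (Ioi R)) :
    Integrable f := by
  have hleft' : IntegrableOn f (Iio (-R)) := by
    simpa using IntegrableOn.comp_neg_Iio (c := -R) (f := fun y => f (-y)) (by simpa)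
  have hcover : (univ : Set ℝ) ⊆ Iio (-R) ∪ Icc (-R) R ∪ Ioi R := fun y _ => by
    rcases lt_or_ge y (-R) with hy | hy
    · exact Or.inl (Or.inl hy)
    · exact (le_or_gt y R).imp (fun hy' => Or.inr ⟨hy, hy'⟩) id
  rw [← integrableOn_univ]
  exact ((hleft'.union hf.integrableOn_Icc).union hright).mono_set hcover

lemma sq_sign_mul {σ : ℝ} (hσ : σ * σ = 1) (x : ℝ) : (σ * x) ^ 2 = x ^ 2 := by
  linear_combination x ^ 2 * hσ

namespace IsBiDecaying

variable {q q₁ q₂ f f' g g' : ℝ → ℝ} {σ R μ₁ μ₂ : ℝ}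

lemma integrable_sq (hσ : σ * σ = 1) (hf : IsBiDecaying q σ R f f') :
    Integrable fun y => f y ^ 2 :=
  integrable_of_integrableOn_tails (hf.continuous.pow 2) hf.integrableOn_sq
    (by simpa only [sq_sign_mul hσ] using hf.left.integrableOn_sq)

lemma tendsto_atBot (hσ : σ * σ = 1) (hf : IsBiDecaying q σ R f f') :
    Tendsto f atBot (𝓝 0) ∧ Tendsto f' atBot (𝓝 0) := by
  have hlim := (hf.left.tendsto.comp tendsto_neg_atBot_atTop).const_mul σ
  have hlim' := (hf.left.tendsto'.comp tendsto_neg_atBot_atTop).const_mul (-σ)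
  rw [mul_zero] at hlim hlim'
  refine ⟨hlim.congr fun y => ?_, hlim'.congr fun y => ?_⟩ <;>
    simp only [Function.comp_apply, neg_neg]
  · linear_combination f y * hσ
  · linear_combination f' y * hσ

lemma mul_nonneg_of_le_abs (hσ : σ * σ = 1) (hf : IsBiDecaying q₁ σ R f f')
    (hg : IsBiDecaying q₂ σ R g g') {y : ℝ} (hy : R ≤ |y|) : 0 ≤ f y * g y := by
  rcases le_abs'.1 hy with hy | hy
  · have hpos := mul_pos (hf.left.pos (-y) (by linarith)) (hg.left.pos (-y) (by linarith))
    simp only [neg_neg] at hpos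
    linear_combination hpos + f y * g y * hσ
  · exact (mul_pos (hf.pos y hy) (hg.pos y hy)).le

lemma integrable_mul (hσ : σ * σ = 1) (hf : IsBiDecaying q₁ σ R f f')
    (hg : IsBiDecaying q₂ σ R g g') : Integrable fun y => f y * g y := by
  refine Integrable.mono' ((hf.integrable_sq hσ).add (hg.integrable_sq hσ))
    (hf.continuous.mul hg.continuous).aestronglyMeasurable (Eventually.of_forall fun y => ?_)
  rw [Real.norm_eq_abs, abs_le]
  simp only [Pi.add_apply]
  constructor <;> nlinarith [sq_nonneg (f y + g y), sq_nonneg (f y - g y)]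

lemma sub_mul_integral_eq_zero (hσ : σ * σ = 1)
    (hf : IsBiDecaying (fun y => q y - μ₁) σ R f f')
    (hg : IsBiDecaying (fun y => q y - μ₂) σ R g g') :
    (μ₁ - μ₂) * ∫ y, f y * g y = 0 := by
  have htop : Tendsto (fun y => f y * g' y - f' y * g y) atTop (𝓝 0) := by
    simpa using (hf.tendsto.mul hg.tendsto').sub (hf.tendsto'.mul hg.tendsto)
  have hbot : Tendsto (fun y => f y * g' y - f' y * g y) atBot (𝓝 0) := by
    simpa using ((hf.tendsto_atBot hσ).1.mul (hg.tendsto_atBot hσ).2).sub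
      ((hf.tendsto_atBot hσ).2.mul (hg.tendsto_atBot hσ).1)
  rw [← integral_const_mul, integral_of_hasDerivAt_of_tendsto
    (fun y => (hf.hasDerivAt_wronskian hg.toIsSol y).congr_deriv
      (show _ = (μ₁ - μ₂) * (f y * g y) by ring))
    ((hf.integrable_mul hσ hg).const_mul _) hbot htop, sub_zero]

end IsBiDecaying

theorem exists_isReference {h : ℝ → ℝ} {σ R : ℝ} (hc : Continuous h) (hi : Integrable h)
    (hσ : σ * σ = 1) (hneg : ∀ y, σ * h (-y) = h y) (hR : 0 < R)
    (hpos : ∀ y, R ≤ y → 0 < h y) :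
    ∃ κ > 0, ∃ S B, IsReference h σ R κ S B := by
  have hRR : -R ≤ R := by linarith
  have hhR := hpos R le_rfl
  set I := ∫ y in (-R)..R, h y ^ 2 with hI
  have hI_pos : 0 < I := intervalIntegral.integral_pos (by linarith) (by fun_prop)
    (fun y _ => sq_nonneg _) ⟨R, right_mem_Icc.2 hRR, by positivity⟩
  set L := ∫ y in (-R)..R, (2 * |h y| + 1) with hL
  have hL_nonneg : 0 ≤ L := intervalIntegral.integral_nonneg hRR fun y _ => by positivity
  obtain ⟨b, hb⟩ := (isCompact_Icc (a := -R) (b := R)).exists_bound_of_continuousOn hc.continuousOn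
  set κ := min (min 1 (h R / 2)) (I / (2 * (L + 1)))
  have hκ1 : κ ≤ 1 := (min_le_left _ _).trans (min_le_left _ _)
  have hκ0 : 0 < κ := by positivity
  have hκI : κ * (2 * (L + 1)) ≤ I := (le_div_iff₀ (by positivity)).1 (min_le_right _ _)
  refine ⟨κ, hκ0, I / 2, b + κ, ⟨hc, hi, hσ, hneg, hR, hpos,
    (min_le_left _ _).trans (min_le_right _ _), by positivity, fun f g hf hg hfh hgh => ?_,
    fun y hy => by gcongr; exact hb y hy⟩⟩
  have mul_ge : ∀ y ∈ Icc (-R) R, h y ^ 2 - κ * (2 * |h y| + 1) ≤ f y * g y := fun y hy => by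
    have hhf : |h y * (f y - h y)| ≤ |h y| * κ := by rw [abs_mul]; gcongr; exact hfh y hy
    have hhg : |h y * (g y - h y)| ≤ |h y| * κ := by rw [abs_mul]; gcongr; exact hgh y hy
    have hfg : |(f y - h y) * (g y - h y)| ≤ κ * 1 := by
      rw [abs_mul]; exact mul_le_mul (hfh y hy) ((hgh y hy).trans hκ1) (abs_nonneg _) hκ0.le
    have := abs_le.1 hhf
    have := abs_le.1 hhg
    have := abs_le.1 hfg
    linarith
  have integral_ge : I - κ * L ≤ ∫ y in (-R)..R, f y * g y := by
    rw [hI, hL, ← intervalIntegral.integral_const_mul, ← intervalIntegral.integral_sub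
      (Continuous.intervalIntegrable (by fun_prop) _ _)
      (Continuous.intervalIntegrable (by fun_prop) _ _)]
    exact intervalIntegral.integral_mono_on hRR (Continuous.intervalIntegrable (by fun_prop) _ _)
      (Continuous.intervalIntegrable (by fun_prop) _ _) mul_ge
  rw [← intervalIntegral.integral_of_le hRR]
  linarith

namespace IsReference

variable {q h f f' g g' : ℝ → ℝ} {σ R κ S B θ μ μ₁ μ₂ : ℝ}

lemma abs_sign (ref : IsReference h σ R κ S B) : |σ| = 1 := by
  rcases mul_self_eq_one_iff.1 ref.sign_mul_self with rfl | rfl <;> simp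

lemma neg_R_mem (ref : IsReference h σ R κ S B) : -R ∈ Icc (-R) R :=
  ⟨le_rfl, by linarith [ref.R_pos]⟩

lemma sign_mul_mem (ref : IsReference h σ R κ S B) (hf : |f (-R) - h (-R)| ≤ κ) :
    σ * f (-R) ∈ Icc (h R / 2) (3 / 2 * h R) := by
  have hclose : |σ * f (-R) - h R| ≤ κ := by
    rw [← ref.sign_mul_map_neg, ← mul_sub, abs_mul, ref.abs_sign, one_mul]
    exact hf
  have := abs_le.1 hclose
  have := ref.κ_le
  constructor <;> linarith

lemma exists_isBiDecaying (ref : IsReference h σ R κ S B) (hq : Tracks q h R κ θ)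
    (hq' : Tracks (fun y => q (-y)) h R κ θ) (hμ : |μ| ≤ θ) (hev : IsL2Eigenvalue q μ) :
    ∃ f f', IsBiDecaying (fun y => q y - μ) σ R f f' ∧ f R = h R := by
  obtain ⟨φ, φ', hφ, hint, hne⟩ := hev
  obtain ⟨c, hc, hqc⟩ := hq.exists_pos_le
  obtain ⟨c', hc', hqc'⟩ := hq'.exists_pos_le
  have hcont : Continuous fun y => q y - μ := hq.continuous.sub continuous_const
  have hhR := ref.pos R le_rfl
  have hφR : φ R ≠ 0 := fun h0 => hne <| funext fun y => by
    obtain ⟨ψ, ψ', hψ, -⟩ := IsDecaying.exists_isDecaying hcont hc (fun y => hqc μ y hμ) one_pos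
    simpa [h0] using hψ.eq_div_mul hcont (fun y hy => hc.le.trans (hqc μ y hμ hy)) hφ
      hint.integrableOn y
  have hf := hφ.const_mul (h R / φ R)
  have hfR : h R / φ R * φ R = h R := div_mul_cancel₀ _ hφR
  have hfint : Integrable fun y => (h R / φ R * φ y) ^ 2 := by
    simpa only [mul_pow] using hint.const_mul ((h R / φ R) ^ 2)
  have hright := IsDecaying.of_integrableOn_sq hcont hc (fun y => hqc μ y hμ) hf
    hfint.integrableOn (hhR.trans_eq hfR.symm)
  have hsign := (ref.sign_mul_mem (f := fun y => h R / φ R * φ y)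
    (hq.close μ _ _ hμ hright hfR (-R) ref.neg_R_mem)).1
  exact ⟨_, _, ⟨hright, IsDecaying.of_integrableOn_sq (hq'.continuous.sub continuous_const) hc'
    (fun y => hqc' μ y hμ) (hf.comp_neg.const_mul σ)
    (by simpa only [sq_sign_mul ref.sign_mul_self] using hfint.comp_neg.integrableOn)
    (lt_of_lt_of_le (by positivity) hsign)⟩, hfR⟩

lemma integral_mul_pos (ref : IsReference h σ R κ S B) {q₁ q₂ : ℝ → ℝ}
    (hf : IsBiDecaying q₁ σ R f f') (hg : IsBiDecaying q₂ σ R g g')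
    (hfh : ∀ y ∈ Icc (-R) R, |f y - h y| ≤ κ) (hgh : ∀ y ∈ Icc (-R) R, |g y - h y| ≤ κ) :
    0 < ∫ y, f y * g y := by
  have hinner := ref.le_integral f g hf.continuous hg.continuous hfh hgh
  have houter : 0 ≤ ∫ y in (Ioc (-R) R)ᶜ, f y * g y :=
    setIntegral_nonneg measurableSet_Ioc.compl fun y hy => by
      refine hf.mul_nonneg_of_le_abs ref.sign_mul_self hg (le_abs'.2 ?_)
      by_contra! hlt
      exact hy ⟨hlt.1, hlt.2.le⟩
  rw [← integral_add_compl (measurableSet_Ioc (a := -R) (b := R))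
    (hf.integrable_mul ref.sign_mul_self hg)]
  linarith [ref.S_pos]

theorem eigenvalue_unique (ref : IsReference h σ R κ S B) (hq : Tracks q h R κ θ)
    (hq' : Tracks (fun y => q (-y)) h R κ θ) (hμ₁ : |μ₁| ≤ θ) (hμ₂ : |μ₂| ≤ θ)
    (hev₁ : IsL2Eigenvalue q μ₁) (hev₂ : IsL2Eigenvalue q μ₂) : μ₁ = μ₂ := by
  obtain ⟨f, f', hf, hfR⟩ := ref.exists_isBiDecaying hq hq' hμ₁ hev₁
  obtain ⟨g, g', hg, hgR⟩ := ref.exists_isBiDecaying hq hq' hμ₂ hev₂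
  have hpos := ref.integral_mul_pos hf hg (hq.close μ₁ f f' hμ₁ hf.toIsDecaying hfR)
    (hq.close μ₂ g g' hμ₂ hg.toIsDecaying hgR)
  have horth := hf.sub_mul_integral_eq_zero ref.sign_mul_self hg
  exact sub_eq_zero.1 ((mul_eq_zero.1 horth).resolve_right hpos.ne')

end IsReference

/-- `u` solves `-u'' + q u = μ₀ u + r` and vanishes at infinity along with `u'`: a quasimode with
quasi-eigenvalue `μ₀` and residual `r`. -/
structure IsQuasimode (q : ℝ → ℝ) (μ₀ : ℝ) (u u' r : ℝ → ℝ) : Prop where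
  deriv₁ : ∀ y, HasDerivAt u (u' y) y
  deriv₂ : ∀ y, HasDerivAt u' ((q y - μ₀) * u y - r y) y
  continuous_residual : Continuous r
  tendsto : Tendsto u (cocompact ℝ) (𝓝 0)
  tendsto' : Tendsto u' (cocompact ℝ) (𝓝 0)

/-- The boundary Wronskian of a right solution `f` and the left solution `y ↦ σ g(-y)`,
at the point `R`. -/
def shootingWronskian (σ R : ℝ) (f f' g g' : ℝ → ℝ) : ℝ :=
  σ * (g (-R) * f' R + g' (-R) * f R)

lemma integrableOn_mul_and_abs_setIntegral_le {f v g : ℝ → ℝ} {s : Set ℝ} {B : ℝ}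
    (hs : MeasurableSet s) (hf : Continuous f) (hv : Continuous v) (hg : Integrable g)
    (hB : 0 ≤ B) (hfB : ∀ y ∈ s, |f y| ≤ B) (hvg : ∀ y, |v y| ≤ g y) :
    IntegrableOn (fun y => f y * v y) s ∧ |∫ y in s, f y * v y| ≤ B * ∫ y, g y := by
  have norm_le : ∀ y ∈ s, ‖f y * v y‖ ≤ B * g y := fun y hy => by
    rw [Real.norm_eq_abs, abs_mul]
    exact mul_le_mul (hfB y hy) (hvg y) (abs_nonneg _) hB
  have hint : IntegrableOn (fun y => f y * v y) s :=
    Integrable.mono' (hg.integrableOn.const_mul B) (hf.mul hv).aestronglyMeasurable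
      ((ae_restrict_iff' hs).2 (Eventually.of_forall norm_le))
  refine ⟨hint, ?_⟩
  calc |∫ y in s, f y * v y| ≤ ∫ y in s, B * g y :=
        (norm_integral_le_integral_norm _).trans
          (setIntegral_mono_on hint.norm (hg.integrableOn.const_mul _) hs norm_le)
    _ ≤ ∫ y, B * g y :=
        setIntegral_le_integral (hg.const_mul _) (Eventually.of_forall fun y =>
          mul_nonneg hB ((abs_nonneg _).trans (hvg y)))
    _ = B * ∫ y, g y := integral_const_mul _ _

namespace IsQuasimode

variable {q u u' r f f' : ℝ → ℝ} {a R μ μ₀ : ℝ}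

lemma continuous (hu : IsQuasimode q μ₀ u u' r) : Continuous u :=
  continuous_iff_continuousAt.2 fun y => (hu.deriv₁ y).continuousAt

lemma reflect (hu : IsQuasimode q μ₀ u u' r) (σ : ℝ) :
    IsQuasimode (fun y => q (-y)) μ₀ (fun y => σ * u (-y)) (fun y => σ * -u' (-y))
      (fun y => σ * r (-y)) := by
  have hneg : Tendsto (fun y : ℝ => -y) (cocompact ℝ) (cocompact ℝ) :=
    (Homeomorph.neg ℝ).isClosedEmbedding.tendsto_cocompact
  refine ⟨fun y => ?_, fun y => ?_, ?_, ?_, ?_⟩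
  · exact (((hu.deriv₁ (-y)).comp y (hasDerivAt_neg y)).const_mul σ).congr_deriv (by ring)
  · exact (((hu.deriv₂ (-y)).comp y (hasDerivAt_neg y)).neg.const_mul σ).congr_deriv (by ring)
  · exact continuous_const.mul (hu.continuous_residual.comp continuous_neg)
  · simpa using (hu.tendsto.comp hneg).const_mul σ
  · simpa using (hu.tendsto'.comp hneg).neg.const_mul σ

lemma sub_mul_setIntegral_sub (hu : IsQuasimode q μ₀ u u' r)
    (hf : IsDecaying (fun y => q y - μ) R f f')
    (hfu : IntegrableOn (fun y => f y * u y) (Ioi a))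
    (hfr : IntegrableOn (fun y => f y * r y) (Ioi a)) :
    (μ - μ₀) * (∫ y in Ioi a, f y * u y) - ∫ y in Ioi a, f y * r y =
      f' a * u a - f a * u' a := by
  have hderiv : ∀ y, HasDerivAt (fun y => f y * u' y - f' y * u y)
      ((μ - μ₀) * (f y * u y) - f y * r y) y := fun y =>
    (((hf.deriv₁ y).mul (hu.deriv₂ y)).sub ((hf.deriv₂ y).mul (hu.deriv₁ y))).congr_deriv (by ring)
  have hlim : Tendsto (fun y => f y * u' y - f' y * u y) atTop (𝓝 0) := by
    simpa using (hf.tendsto.mul (hu.tendsto'.mono_left atTop_le_cocompact)).sub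
      (hf.tendsto'.mul (hu.tendsto.mono_left atTop_le_cocompact))
  rw [← integral_const_mul, ← integral_sub (hfu.const_mul _) hfr,
    integral_Ioi_of_hasDerivAt_of_tendsto' (fun y _ => hderiv y) ((hfu.const_mul _).sub hfr) hlim]
  ring

end IsQuasimode

namespace IsReference

variable {q h f f' g g' u u' r G : ℝ → ℝ} {σ R κ S B θ μ μ₀ γ ρ s a c : ℝ}

lemma abs_le_of_close (ref : IsReference h σ R κ S B) (hf : IsDecaying q R f f')
    (hclose : ∀ y ∈ Icc (-R) R, |f y - h y| ≤ κ) {y : ℝ} (hy : -R ≤ y) :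
    |f y| ≤ B := by
  have hRR : -R ≤ R := by linarith [ref.R_pos]
  have hle : ∀ x ∈ Icc (-R) R, |f x| ≤ B := fun x hx => by
    linarith [abs_sub_abs_le_abs_sub (f x) (h x), hclose x hx, ref.abs_add_κ_le x hx]
  rcases le_total y R with hyR | hyR
  · exact hle y ⟨hy, hyR⟩
  · rw [abs_of_pos (hf.pos y hyR)]
    exact (hf.le y hyR).trans ((le_abs_self _).trans (hle R ⟨hRR, le_rfl⟩))

lemma le_setIntegral_Ioi (ref : IsReference h σ R κ S B) (hf : IsDecaying q R f f')
    (hclose : ∀ y ∈ Icc (-R) R, |f y - h y| ≤ κ)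
    (hint : IntegrableOn (fun y => f y * h y) (Ioi (-R))) :
    0 ≤ ∫ y in Ioi R, f y * h y ∧ S ≤ ∫ y in Ioi (-R), f y * h y := by
  have hRR : -R ≤ R := by linarith [ref.R_pos]
  have houter : 0 ≤ ∫ y in Ioi R, f y * h y := setIntegral_nonneg measurableSet_Ioi
    fun y hy => mul_nonneg (hf.pos y (le_of_lt hy)).le (ref.pos y (le_of_lt hy)).le
  have hκ : 0 ≤ κ := (abs_nonneg _).trans (hclose R ⟨hRR, le_rfl⟩)
  have hinner := ref.le_integral f h hf.continuous ref.continuous hclose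
    fun y _ => by rwa [sub_self, abs_zero]
  refine ⟨houter, ?_⟩
  rw [← Ioc_union_Ioi_eq_Ioi hRR, setIntegral_union Ioc_disjoint_Ioi_same measurableSet_Ioi
    (hint.mono_set Ioc_subset_Ioi_self) (hint.mono_set (Ioi_subset_Ioi hRR))]
  linarith

lemma exists_pairing (ref : IsReference h σ R κ S B)
    (hf : IsDecaying (fun y => q y - μ) R f f')
    (hclose : ∀ y ∈ Icc (-R) R, |f y - h y| ≤ κ) (hu : IsQuasimode q μ₀ u u' r)
    (hG : Integrable G) (huh : ∀ y, |u y - h y| ≤ γ * G y) (hr : ∀ y, |r y| ≤ ρ * G y)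
    (ha : -R ≤ a) (hc : c ≤ ∫ y in Ioi a, f y * h y) :
    ∃ I J, (μ - μ₀) * I - J = f' a * u a - f a * u' a ∧
      c - B * γ * (∫ y, G y) ≤ I ∧ |J| ≤ B * ρ * ∫ y, G y := by
  have hfB : ∀ y ∈ Ioi a, |f y| ≤ B := fun y hy =>
    ref.abs_le_of_close hf hclose (ha.trans (le_of_lt hy))
  have hB : 0 ≤ B := (abs_nonneg _).trans (ref.abs_le_of_close hf hclose le_rfl)
  obtain ⟨hfr, hfr_le⟩ := integrableOn_mul_and_abs_setIntegral_le measurableSet_Ioi hf.continuous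
    hu.continuous_residual (hG.const_mul ρ) hB hfB hr
  obtain ⟨hfd, hfd_le⟩ := integrableOn_mul_and_abs_setIntegral_le measurableSet_Ioi hf.continuous
    (hu.continuous.sub ref.continuous) (hG.const_mul γ) hB hfB huh
  obtain ⟨hfh, -⟩ := integrableOn_mul_and_abs_setIntegral_le measurableSet_Ioi hf.continuous
    ref.continuous ref.integrable.abs hB hfB fun y => le_rfl
  rw [integral_const_mul, ← mul_assoc] at hfr_le hfd_le
  simp only [Pi.sub_apply] at hfd hfd_le
  have split : (fun y => f y * u y) = fun y => f y * h y + f y * (u y - h y) := by ext; ring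
  have hfu : IntegrableOn (fun y => f y * u y) (Ioi a) := split ▸ hfh.add hfd
  refine ⟨_, _, hu.sub_mul_setIntegral_sub hf hfu hfr, ?_, hfr_le⟩
  rw [split, integral_add hfh hfd]
  linarith [neg_le_of_abs_le hfd_le]

lemma integrableOn_mul (ref : IsReference h σ R κ S B) (hf : IsDecaying q R f f')
    (hclose : ∀ y ∈ Icc (-R) R, |f y - h y| ≤ κ) :
    IntegrableOn (fun y => f y * h y) (Ioi (-R)) :=
  (integrableOn_mul_and_abs_setIntegral_le measurableSet_Ioi hf.continuous ref.continuous
    ref.integrable.abs ((abs_nonneg _).trans (ref.abs_le_of_close hf hclose le_rfl))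
    (fun _ hy => ref.abs_le_of_close hf hclose (le_of_lt hy)) fun _ => le_rfl).1

theorem exists_shootingWronskian_mul_eq (ref : IsReference h σ R κ S B)
    (hf : IsDecaying (fun y => q y - μ) R f f') (hfR : f R = h R)
    (hfh : ∀ y ∈ Icc (-R) R, |f y - h y| ≤ κ)
    (hg : IsDecaying (fun y => q (-y) - μ) R g g')
    (hgh : ∀ y ∈ Icc (-R) R, |g y - h y| ≤ κ) (hu : IsQuasimode q μ₀ u u' r)
    (hG : Integrable G) (huh : ∀ y, |u y - h y| ≤ γ * G y) (hr : ∀ y, |r y| ≤ ρ * G y) :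
    ∃ I J, shootingWronskian σ R f f' g g' * u R = (μ - μ₀) * I - J ∧
      h R * (S - 5 / 2 * (B * γ * ∫ y, G y)) ≤ I ∧ |J| ≤ h R * (5 / 2 * (B * ρ * ∫ y, G y)) := by
  have hRR : -R ≤ R := by linarith [ref.R_pos]
  have hreflect : ∀ {c v w}, |v - w| ≤ c → |σ * v - σ * w| ≤ c := fun {c v w} hle => by
    rwa [← mul_sub, abs_mul, ref.abs_sign, one_mul]
  obtain ⟨I₁, J₁, h₁, hI₁, hJ₁⟩ := ref.exists_pairing hf hfh hu hG huh hr hRR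
    (ref.le_setIntegral_Ioi hf hfh (ref.integrableOn_mul hf hfh)).1
  obtain ⟨I₂, J₂, h₂, hI₂, hJ₂⟩ := ref.exists_pairing hg hgh (hu.reflect σ) hG.comp_neg
    (fun y => by simpa only [ref.sign_mul_map_neg] using hreflect (huh (-y)))
    (fun y => by simpa using hreflect (w := 0) (by simpa using hr (-y))) le_rfl
    (ref.le_setIntegral_Ioi hg hgh (ref.integrableOn_mul hg hgh)).2
  rw [integral_neg_eq_self G volume] at hI₂ hJ₂
  simp only [neg_neg] at h₂
  obtain ⟨hL, hL'⟩ := ref.sign_mul_mem (hgh (-R) ref.neg_R_mem)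
  have hR := ref.pos R le_rfl
  set L := σ * g (-R) with hL_def
  set E := B * γ * ∫ y, G y
  set F := B * ρ * ∫ y, G y
  have hE : 0 ≤ E := by
    have hB := (abs_nonneg _).trans (ref.abs_le_of_close hf hfh le_rfl)
    rw [show E = B * ∫ y, γ * G y by rw [integral_const_mul, ← mul_assoc]]
    exact mul_nonneg hB (integral_nonneg fun y => (abs_nonneg _).trans (huh y))
  have hL0 : 0 ≤ L := by linarith
  refine ⟨L * I₁ + h R * I₂, L * J₁ + h R * J₂, ?_, ?_, ?_⟩
  · rw [shootingWronskian, hfR]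
    rw [hfR] at h₁
    linear_combination -L * h₁ - h R * h₂
  · linarith [mul_le_mul_of_nonneg_left hI₁ hL0, mul_le_mul_of_nonneg_left hI₂ hR.le,
      mul_le_mul_of_nonneg_right hL' hE]
  · calc |L * J₁ + h R * J₂| ≤ L * |J₁| + h R * |J₂| := by
          refine (abs_add_le _ _).trans_eq ?_
          rw [abs_mul L, abs_mul (h R), abs_of_nonneg hL0, abs_of_pos hR]
      _ ≤ 3 / 2 * h R * F + h R * F := by gcongr
      _ = h R * (5 / 2 * F) := by ring

theorem isL2Eigenvalue_of_shootingWronskian_eq_zero (ref : IsReference h σ R κ S B)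
    (hq : Continuous q) (hf : IsDecaying (fun y => q y - μ) R f f')
    (hg : IsDecaying (fun y => q (-y) - μ) R g g')
    (hgh : ∀ y ∈ Icc (-R) R, |g y - h y| ≤ κ) (hW : shootingWronskian σ R f f' g g' = 0) :
    IsL2Eigenvalue q μ := by
  have hleft : IsSol (fun y => q y - μ) (fun y => σ * g (-y)) (fun y => σ * -g' (-y)) := by
    simpa only [neg_neg] using hg.toIsSol.comp_neg.const_mul σ
  have hprop := hleft.eq_div_mul_of_wronskian_eq_zero (hq.sub continuous_const) hf.toIsSol
    (hf.pos R le_rfl).ne' (by rw [shootingWronskian] at hW; linear_combination hW)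
  refine ⟨_, _, hleft, integrable_of_integrableOn_tails (R := R) (hleft.continuous.pow 2) ?_ ?_,
    fun h0 => ?_⟩
  · exact (hf.integrableOn_sq.const_mul ((σ * g (-R) / f R) ^ 2)).congr
      (Eventually.of_forall fun y => by simp only [hprop y, mul_pow])
  · simpa only [neg_neg, sq_sign_mul ref.sign_mul_self] using hg.integrableOn_sq
  · have hpos := (ref.sign_mul_mem (hgh (-R) ref.neg_R_mem)).1
    rw [show σ * g (-R) = 0 from congrFun h0 R] at hpos
    linarith [ref.pos R le_rfl]

lemma continuousOn_shootingWronskian {F F' H H' : ℝ → ℝ → ℝ} {t : Set ℝ}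
    (ref : IsReference h σ R κ S B) (hq : Continuous q)
    (hF : ∀ μ ∈ t, IsDecaying (fun y => q y - μ) R (F μ) (F' μ) ∧ F μ R = h R)
    (hH : ∀ μ ∈ t, IsDecaying (fun y => q (-y) - μ) R (H μ) (H' μ) ∧ H μ R = h R) :
    ContinuousOn (fun μ => shootingWronskian σ R (F μ) (F' μ) (H μ) (H' μ)) t := by
  obtain ⟨hF₁, hF₂⟩ := IsDecaying.continuousOn_family (y := R) ref.R_pos hq
    (fun μ hμ => (hF μ hμ).1) (fun μ hμ => (hF μ hμ).2) ⟨by linarith [ref.R_pos], le_rfl⟩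
  obtain ⟨hH₁, hH₂⟩ := IsDecaying.continuousOn_family ref.R_pos (hq.comp continuous_neg)
    (fun μ hμ => (hH μ hμ).1) (fun μ hμ => (hH μ hμ).2) ref.neg_R_mem
  exact continuousOn_const.mul ((hH₁.mul hF₂).add (hH₂.mul hF₁))

end IsReference

lemma Tracks.exists_isDecaying {q h : ℝ → ℝ} {R κ θ : ℝ} (hq : Tracks q h R κ θ)
    (hR : 0 < h R) : ∃ F F' : ℝ → ℝ → ℝ, ∀ μ, |μ| ≤ θ →
      IsDecaying (fun y => q y - μ) R (F μ) (F' μ) ∧ F μ R = h R := by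
  obtain ⟨c, hc, hqc⟩ := hq.exists_pos_le
  choose! F F' hF using fun μ (hμ : |μ| ≤ θ) => IsDecaying.exists_isDecaying (R := R)
    (hq.continuous.sub continuous_const) hc (fun y => hqc μ y hμ) hR
  exact ⟨F, F', hF⟩

lemma exists_eq_zero_of_mul_eq_mul_sub {W : ℝ → ℝ} {μ₀ s c d : ℝ} (hc : 0 < c) (hs : 0 ≤ s)
    (hW : ContinuousOn W (Icc (μ₀ - s) (μ₀ + s)))
    (heq : ∀ μ ∈ Icc (μ₀ - s) (μ₀ + s), ∃ I J, W μ * c = (μ - μ₀) * I - J ∧ d ≤ I ∧ |J| ≤ d * s) :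
    ∃ μ ∈ Icc (μ₀ - s) (μ₀ + s), W μ = 0 := by
  have hle : μ₀ - s ≤ μ₀ + s := by linarith
  have hW_nonpos : W (μ₀ - s) ≤ 0 := by
    obtain ⟨I, J, hWc, hI, hJ⟩ := heq _ (left_mem_Icc.2 hle)
    refine nonpos_of_mul_nonpos_left ?_ hc
    linarith [neg_le_of_abs_le hJ, mul_le_mul_of_nonneg_right hI hs]
  have hW_nonneg : 0 ≤ W (μ₀ + s) := by
    obtain ⟨I, J, hWc, hI, hJ⟩ := heq _ (right_mem_Icc.2 hle)
    refine nonneg_of_mul_nonneg_left ?_ hc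
    linarith [le_of_abs_le hJ, mul_le_mul_of_nonneg_right hI hs]
  exact intermediate_value_Icc hle hW ⟨hW_nonpos, hW_nonneg⟩

theorem IsReference.exists_eigenvalue {q h u u' r G : ℝ → ℝ} {σ R κ S B θ μ₀ γ ρ s : ℝ}
    (ref : IsReference h σ R κ S B)
    (hq : Tracks q h R κ θ) (hq' : Tracks (fun y => q (-y)) h R κ θ)
    (hu : IsQuasimode q μ₀ u u' r) (hG : Integrable G) (huh : ∀ y, |u y - h y| ≤ γ * G y)
    (hr : ∀ y, |r y| ≤ ρ * G y) (hγR : γ * G R < h R) (hγ : 5 * (B * γ * ∫ y, G y) ≤ S)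
    (hρ : 5 * (B * ρ * ∫ y, G y) ≤ S * s) (hs : 0 ≤ s) (hμ₀ : |μ₀| + s ≤ θ) :
    ∃ μ, |μ - μ₀| ≤ s ∧ IsL2Eigenvalue q μ := by
  have hhR := ref.pos R le_rfl
  have mem : ∀ μ ∈ Icc (μ₀ - s) (μ₀ + s), |μ - μ₀| ≤ s ∧ |μ| ≤ θ := fun μ hμ => by
    have hμs : |μ - μ₀| ≤ s := abs_le.2 ⟨by linarith [hμ.1], by linarith [hμ.2]⟩
    exact ⟨hμs, by linarith [abs_sub_abs_le_abs_sub μ μ₀]⟩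
  obtain ⟨F, F', hF⟩ := hq.exists_isDecaying hhR
  obtain ⟨H, H', hH⟩ := hq'.exists_isDecaying hhR
  have hHh : ∀ μ, |μ| ≤ θ → ∀ y ∈ Icc (-R) R, |H μ y - h y| ≤ κ := fun μ hμ =>
    hq'.close μ _ _ hμ (hH μ hμ).1 (hH μ hμ).2
  obtain ⟨μ, hμ, hWμ⟩ := exists_eq_zero_of_mul_eq_mul_sub (d := h R * S / 2)
    (by linarith [neg_le_of_abs_le (huh R)] : 0 < u R) hs
    (ref.continuousOn_shootingWronskian hq.continuous (fun μ hμ => hF μ (mem μ hμ).2)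
      fun μ hμ => hH μ (mem μ hμ).2) fun μ hμ => by
    have hμθ := (mem μ hμ).2
    obtain ⟨I, J, heq, hI, hJ⟩ := ref.exists_shootingWronskian_mul_eq (hF μ hμθ).1 (hF μ hμθ).2
      (hq.close μ _ _ hμθ (hF μ hμθ).1 (hF μ hμθ).2) (hH μ hμθ).1 (hHh μ hμθ) hu hG huh hr
    exact ⟨I, J, heq, by nlinarith, by nlinarith⟩
  obtain ⟨hμs, hμθ⟩ := mem μ hμ
  exact ⟨μ, hμs, ref.isL2Eigenvalue_of_shootingWronskian_eq_zero hq.continuous (hF μ hμθ).1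
    (hH μ hμθ).1 (hHh μ hμθ) hWμ⟩

/-! ### Formal perturbation theory of the harmonic oscillator -/

section Formal

open Polynomial

/-- The monic Hermite polynomials for the weight `exp (-y²)`. -/
noncomputable def monicHermite : ℕ → ℝ[X]
  | 0 => 1
  | m + 1 => X * monicHermite m - C (1 / 2) * derivative (monicHermite m)

lemma derivative_derivative_monicHermite (m : ℕ) :
    derivative (derivative (monicHermite m)) =
      2 * X * derivative (monicHermite m) - C (2 * (m : ℝ)) * monicHermite m := by
  induction m with
  | zero => simp [monicHermite]
  | succ m ih =>
    have hd : derivative (monicHermite (m + 1)) = C ((m : ℝ) + 1) * monicHermite m := by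
      simp only [monicHermite, derivative_sub, derivative_mul, derivative_X, derivative_C, ih]
      refine Polynomial.funext fun r => ?_
      simp only [one_mul, zero_mul, one_div, map_mul, map_natCast, zero_add, eval_sub, eval_add,
        eval_mul, eval_X, eval_C, eval_ofNat, eval_natCast, map_add, map_one, eval_one]
      ring
    rw [hd]
    simp only [derivative_mul, derivative_C, monicHermite]
    refine Polynomial.funext fun r => ?_
    simp only [zero_mul, map_add, map_natCast, map_one, zero_add, eval_mul, eval_add,
      eval_natCast, eval_one, Nat.cast_add, Nat.cast_one, map_mul, one_div, eval_sub, eval_ofNat,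
      eval_X, eval_C]
    ring

lemma monic_monicHermite_and_natDegree (m : ℕ) :
    (monicHermite m).Monic ∧ (monicHermite m).natDegree = m := by
  induction m with
  | zero => simp [monicHermite]
  | succ m ih =>
    have hmonic : (X * monicHermite m).Monic := monic_X.mul ih.1
    have hnat : (X * monicHermite m).natDegree = m + 1 := by
      rw [monic_X.natDegree_mul ih.1, natDegree_X, ih.2, add_comm]
    have hlt : (C (1 / 2) * derivative (monicHermite m)).degree < (X * monicHermite m).degree := by
      rw [degree_eq_natDegree hmonic.ne_zero, hnat, degree_C_mul (by norm_num)]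
      refine degree_derivative_le.trans_lt ?_
      rw [degree_eq_natDegree ih.1.ne_zero, ih.2]
      exact_mod_cast Nat.lt_succ_self m
    refine ⟨hmonic.sub_of_left hlt, ?_⟩
    rw [monicHermite, natDegree_eq_of_degree_eq (degree_sub_eq_left_of_degree_lt hlt), hnat]

lemma monic_monicHermite (m : ℕ) : (monicHermite m).Monic :=
  (monic_monicHermite_and_natDegree m).1

lemma degree_monicHermite (m : ℕ) : (monicHermite m).degree = m := by
  rw [degree_eq_natDegree (monic_monicHermite m).ne_zero, (monic_monicHermite_and_natDegree m).2]

lemma monicHermite_comp_neg_X (m : ℕ) :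
    (monicHermite m).comp (-X) = (-1) ^ m * monicHermite m := by
  induction m with
  | zero => simp [monicHermite]
  | succ m ih =>
    have hd : (derivative (monicHermite m)).comp (-X) =
        -((-1) ^ m * derivative (monicHermite m)) := by
      have h := congrArg derivative ih
      have hc : derivative ((-1 : ℝ[X]) ^ m) = 0 := by
        rw [show (-1 : ℝ[X]) = C (-1) by simp, ← C_pow, derivative_C]
      rw [derivative_comp, derivative_mul, hc, derivative_neg, derivative_X] at h
      linear_combination -h
    simp only [monicHermite, sub_comp, mul_comp, X_comp, C_comp, ih, hd]
    ring

/-- The harmonic oscillator `-∂² + y² - (2n+1)` conjugated by the Gaussian `exp (-y²/2)`, acting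
on polynomials. -/
noncomputable def oscillator (n : ℕ) : ℝ[X] →ₗ[ℝ] ℝ[X] :=
  -(derivative ∘ₗ derivative) + LinearMap.mulLeft ℝ (2 * X) ∘ₗ derivative
    - (2 * (n : ℝ)) • LinearMap.id

lemma oscillator_apply (n : ℕ) (q : ℝ[X]) : oscillator n q =
    -derivative (derivative q) + 2 * X * derivative q - C (2 * (n : ℝ)) * q := by
  simp [oscillator, smul_eq_C_mul, mul_assoc]

lemma oscillator_monicHermite (n : ℕ) : oscillator n (monicHermite n) = 0 := by
  rw [oscillator_apply, derivative_derivative_monicHermite]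
  ring

lemma oscillator_X_pow (n m : ℕ) : oscillator n (X ^ m) =
    (2 * ((m : ℝ) - n)) • X ^ m - ((m : ℝ) * (m - 1)) • X ^ (m - 2) := by
  rw [oscillator_apply]
  refine Polynomial.funext fun r => ?_
  rcases m with _ | _ | m
  · simp
  · simp; ring
  · simp; ring

lemma mem_of_degree_lt_of_X_pow_mem {S : Submodule ℝ ℝ[X]} {f : ℝ[X]} {m : ℕ}
    (hf : f.degree < m) (hS : ∀ i < m, X ^ i ∈ S) : f ∈ S := by
  rw [f.as_sum_support_C_mul_X_pow]
  refine S.sum_mem fun i hi => ?_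
  rw [← smul_eq_C_mul]
  exact S.smul_mem _ (hS i (by exact_mod_cast (le_degree_of_mem_supp i hi).trans_lt hf))

-- `oscillator n` is triangular in the basis `X ^ m`, with diagonal entries `2 * (m - n)`; the one
-- that vanishes is compensated by the Hermite polynomial, which is monic of degree `n`.
lemma range_oscillator_sup_span_monicHermite (n : ℕ) :
    LinearMap.range (oscillator n) ⊔ ℝ ∙ monicHermite n = ⊤ := by
  set S := LinearMap.range (oscillator n) ⊔ ℝ ∙ monicHermite n
  suffices hX : ∀ m : ℕ, (X ^ m : ℝ[X]) ∈ S from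
    eq_top_iff.2 fun f _ =>
      mem_of_degree_lt_of_X_pow_mem
        (degree_le_natDegree.trans_lt (by exact_mod_cast f.natDegree.lt_succ_self)) fun i _ => hX i
  intro m
  induction m using Nat.strong_induction_on with | _ m ih
  rcases eq_or_ne m n with rfl | hmn
  · have hlt : (X ^ m - monicHermite m).degree < (m : WithBot ℕ) := by
      have h := degree_sub_lt_left (p := (X ^ m : ℝ[X])) (q := monicHermite m)
        (by rw [degree_X_pow, degree_monicHermite]) (by simp)
        (by simp [(monic_monicHermite m).leadingCoeff])
      rwa [degree_X_pow] at h
    have hH : monicHermite m ∈ S :=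
      Submodule.mem_sup_right (Submodule.mem_span_singleton_self _)
    simpa using S.add_mem (mem_of_degree_lt_of_X_pow_mem hlt ih) hH
  · have hne : (2 * ((m : ℝ) - n)) ≠ 0 :=
      mul_ne_zero two_ne_zero (sub_ne_zero.2 (by exact_mod_cast hmn))
    have hlow : ((m : ℝ) * (m - 1)) • (X ^ (m - 2) : ℝ[X]) ∈ S := by
      rcases m with _ | _ | m
      · simp
      · simp
      · exact S.smul_mem _ (ih _ (by omega))
    have hmem := S.smul_mem (2 * ((m : ℝ) - n))⁻¹
      (S.add_mem (Submodule.mem_sup_left ⟨X ^ m, rfl⟩) hlow)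
    rwa [oscillator_X_pow, sub_add_cancel, smul_smul, inv_mul_cancel₀ hne, one_smul] at hmem

lemma exists_oscillator_add_eq (n : ℕ) (f : ℝ[X]) :
    ∃ s : ℝ × ℝ[X], oscillator n s.2 + f = C s.1 * monicHermite n := by
  have hf : f ∈ LinearMap.range (oscillator n) ⊔ ℝ ∙ monicHermite n := by
    rw [range_oscillator_sup_span_monicHermite]
    exact Submodule.mem_top
  obtain ⟨_, ⟨q, rfl⟩, _, hc, rfl⟩ := Submodule.mem_sup.1 hf
  obtain ⟨c, rfl⟩ := Submodule.mem_span_singleton.1 hc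
  exact ⟨(c, -q), by rw [map_neg, smul_eq_C_mul]; ring⟩

/-- The recursion of formal perturbation theory for the pairs (eigenvalue coefficient,
eigenfunction coefficient), with prescribed terms of order at most two. Here `solve` inverts the
unperturbed operator up to a multiple of its eigenfunction, and `W` lists the Taylor coefficients
of the perturbation. -/
noncomputable def perturbationSeq (solve : ℝ[X] → ℝ × ℝ[X]) (W : ℕ → ℝ[X])
    (s₀ s₁ s₂ : ℝ × ℝ[X]) : ℕ → ℝ × ℝ[X]
  | 0 => s₀
  | 1 => s₁
  | 2 => s₂
  | m + 3 => solve (W (m + 3) * s₀.2 + ∑ i : Fin (m + 2),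
      (W (i + 1) - C (perturbationSeq solve W s₀ s₁ s₂ (i + 1)).1) *
        (perturbationSeq solve W s₀ s₁ s₂ (m + 2 - i)).2)
termination_by m => m
decreasing_by
  · have := i.2; omega
  · omega

lemma perturbationSeq_add_three (solve : ℝ[X] → ℝ × ℝ[X]) (W : ℕ → ℝ[X])
    (s₀ s₁ s₂ : ℝ × ℝ[X]) (m : ℕ) :
    perturbationSeq solve W s₀ s₁ s₂ (m + 3) =
      solve (W (m + 3) * s₀.2 + ∑ i ∈ Finset.range (m + 2),
        (W (i + 1) - C (perturbationSeq solve W s₀ s₁ s₂ (i + 1)).1) *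
          (perturbationSeq solve W s₀ s₁ s₂ (m + 2 - i)).2) := by
  rw [perturbationSeq, Finset.sum_range (n := m + 2)]

theorem exists_perturbation_series (n : ℕ) {W : ℕ → ℝ[X]} (hW : W 0 = 0) {q₁ q₂ : ℝ[X]} {c : ℝ}
    (h₁ : oscillator n q₁ + W 1 * monicHermite n = 0)
    (h₂ : oscillator n q₂ + W 1 * q₁ + (W 2 - C c) * monicHermite n = 0) :
    ∃ (Λ : ℕ → ℝ) (q : ℕ → ℝ[X]), Λ 0 = 0 ∧ Λ 1 = 0 ∧ Λ 2 = c ∧ q 0 = monicHermite n ∧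
      ∀ j, oscillator n (q j) +
        ∑ il ∈ Finset.HasAntidiagonal.antidiagonal j, (W il.1 - C (Λ il.1)) * q il.2 = 0 := by
  choose solve hsolve using exists_oscillator_add_eq n
  set s := perturbationSeq solve W (0, monicHermite n) (0, q₁) (c, q₂) with hs
  have s0 : s 0 = (0, monicHermite n) := by rw [hs, perturbationSeq]
  have s1 : s 1 = (0, q₁) := by rw [hs, perturbationSeq]
  have s2 : s 2 = (c, q₂) := by rw [hs, perturbationSeq]
  refine ⟨fun j => (s j).1, fun j => (s j).2, by simp [s0], by simp [s1], by simp [s2],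
    by simp [s0], fun j => ?_⟩
  rw [Finset.Nat.sum_antidiagonal_eq_sum_range_succ (fun i l => (W i - C (s i).1) * (s l).2) j]
  rcases j with _ | _ | _ | m
  · simp [s0, hW, oscillator_monicHermite]
  · simp only [zero_add, s1, Nat.succ_eq_add_one, Nat.reduceAdd, Finset.sum_range_succ,
      Finset.range_one, Finset.sum_singleton, hW, s0, map_zero, sub_self, tsub_zero, zero_mul,
      sub_zero, tsub_self]
    linear_combination h₁
  · simp only [zero_add, Nat.reduceAdd, s2, Nat.succ_eq_add_one, Finset.sum_range_succ,
      Finset.range_one, Finset.sum_singleton, hW, s0, map_zero, sub_self, tsub_zero, zero_mul, s1,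
      sub_zero, Nat.add_one_sub_one, tsub_self]
    linear_combination h₂
  · have hm := hsolve (W (m + 3) * monicHermite n + ∑ i ∈ Finset.range (m + 2),
      (W (i + 1) - C (s (i + 1)).1) * (s (m + 2 - i)).2)
    rw [← perturbationSeq_add_three solve W (0, monicHermite n) (0, q₁) (c, q₂), ← hs] at hm
    rw [Finset.sum_range_succ, Finset.sum_range_succ']
    have hsub : ∀ i, m + 3 - (i + 1) = m + 2 - i := fun i => Nat.add_sub_add_right (m + 2) 1 i
    simp only [hsub, add_assoc, Nat.reduceAdd, Nat.sub_self, Nat.sub_zero, s0,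
      hW, C_0] at hm ⊢
    linear_combination hm

end Formal

/-! ### The potential -/

/-- The potential `p_ε² - (2n+1) p_ε'` of `B_{0,ε}`; the derivative is `p_ε' = (1 + ε y)^(k-1)`. -/
noncomputable def potential (k n : ℕ) (ε y : ℝ) : ℝ :=
  pFun k ε y ^ 2 - (2 * (n : ℝ) + 1) * (1 + ε * y) ^ (k - 1)

section Potential

open Polynomial

variable {k : ℕ}

lemma pFun_eq_mul_geom_sum (hk : 1 ≤ k) (ε y : ℝ) :
    pFun k ε y = y * (∑ i ∈ Finset.range k, (1 + ε * y) ^ i) / k := by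
  have hk0 : (k : ℝ) ≠ 0 := by positivity
  by_cases hε : ε = 0
  · simp [pFun, hε, hk0]
  · rw [pFun, if_neg hε, ← geom_sum_mul, add_sub_cancel_left]
    field_simp

lemma hasDerivAt_pFun (hk : 1 ≤ k) (ε y : ℝ) :
    HasDerivAt (pFun k ε) ((1 + ε * y) ^ (k - 1)) y := by
  have hk0 : (k : ℝ) ≠ 0 := by positivity
  by_cases hε : ε = 0
  · have hp : pFun k ε = fun y => y := by ext y; simp [pFun, hε]
    rw [hp]
    simpa [hε] using hasDerivAt_id' y
  · have hp : pFun k ε = fun y => (ε * k)⁻¹ * ((1 + ε * y) ^ k - 1) := by ext y; simp [pFun, hε]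
    have hlin : HasDerivAt (fun y => 1 + ε * y) ε y := by
      simpa using ((hasDerivAt_id y).const_mul ε).const_add 1
    rw [hp]
    refine (((hlin.pow k).sub_const 1).const_mul (ε * k)⁻¹).congr_deriv ?_
    field_simp

lemma continuous_potential (hk : 1 ≤ k) (n : ℕ) (ε : ℝ) : Continuous (potential k n ε) := by
  have hp : Continuous (pFun k ε) :=
    continuous_iff_continuousAt.2 fun y => (hasDerivAt_pFun hk ε y).continuousAt
  unfold potential
  fun_prop

lemma potential_neg_neg (k n : ℕ) (ε y : ℝ) : potential k n (-ε) (-y) = potential k n ε y := by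
  have hp : pFun k (-ε) (-y) = -pFun k ε y := by
    by_cases hε : ε = 0
    · simp [pFun, hε]
    · simp [pFun, hε, inv_neg]
  simp [potential, hp]

lemma potential_zero (k n : ℕ) (y : ℝ) : potential k n 0 y = y ^ 2 - (2 * (n : ℝ) + 1) := by
  simp [potential, pFun]

lemma max_one_abs_pow_le_abs_geom_sum {s : ℝ} (hk : 1 ≤ k) (hs : 0 ≤ s) :
    max 1 (|s| ^ (k - 1)) ≤ |∑ i ∈ Finset.range k, s ^ i| := by
  have hterm : ∀ j ∈ Finset.range k, s ^ j ≤ ∑ i ∈ Finset.range k, s ^ i := fun j hj =>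
    Finset.single_le_sum (f := fun i => s ^ i) (fun i _ => pow_nonneg hs i) hj
  refine le_trans (max_le ?_ ?_) (le_abs_self _)
  · simpa using hterm 0 (Finset.mem_range.2 hk)
  · simpa [abs_of_nonneg hs] using hterm (k - 1) (Finset.mem_range.2 (by omega))

lemma max_one_abs_pow_le_abs_pow_sub_one {s : ℝ} (hk : Odd k) (hs : s ≤ 0) :
    max 1 (|s| ^ (k - 1)) ≤ |s ^ k - 1| := by
  have heq : |s ^ k - 1| = |s| ^ k + 1 := by
    rw [abs_of_nonpos (by linarith [hk.pow_nonpos hs]), abs_of_nonpos hs, hk.neg_pow]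
    ring
  rw [heq]
  refine max_le (by linarith [pow_nonneg (abs_nonneg s) k]) ?_
  rcases le_total |s| 1 with h | h
  · linarith [pow_le_one₀ (n := k - 1) (abs_nonneg s) h, pow_nonneg (abs_nonneg s) k]
  · linarith [pow_le_pow_right₀ h (Nat.sub_le k 1)]

lemma mul_abs_pow_sub_one_le_abs_pFun (hk : 1 ≤ k) {M ε y : ℝ} (hM : 0 < M)
    (hε : |ε| ≤ 1 / (k * M)) (hε0 : ε ≠ 0) :
    M * |(1 + ε * y) ^ k - 1| ≤ |pFun k ε y| := by
  rw [pFun, if_neg hε0, abs_mul, abs_inv, abs_mul, Nat.abs_cast]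
  gcongr
  rw [le_inv_comm₀ hM (by positivity)]
  calc |ε| * k ≤ 1 / (k * M) * k := by gcongr
    _ = M⁻¹ := by field_simp

-- The excluded case `1 + ε y < 0` with `k` even is the one where `p_ε` can vanish far away.
lemma mul_max_one_abs_pow_le_abs_pFun (hk : 1 ≤ k) {M ε y : ℝ} (hM : 0 < M)
    (hε : |ε| ≤ 1 / (k * M)) (hy : k * M ≤ |y|) (h : 0 ≤ 1 + ε * y ∨ Odd k) :
    M * max 1 (|1 + ε * y| ^ (k - 1)) ≤ |pFun k ε y| := by
  have hkp : (0 : ℝ) < k := by positivity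
  by_cases hs : 0 ≤ 1 + ε * y
  · rw [pFun_eq_mul_geom_sum hk, abs_div, abs_mul, Nat.abs_cast, le_div_iff₀ hkp]
    calc M * max 1 (|1 + ε * y| ^ (k - 1)) * k = k * M * max 1 (|1 + ε * y| ^ (k - 1)) := by ring
      _ ≤ |y| * |∑ i ∈ Finset.range k, (1 + ε * y) ^ i| := by
        gcongr
        exact max_one_abs_pow_le_abs_geom_sum hk hs
  · have hε0 : ε ≠ 0 := by
      rintro rfl
      simp at hs
    refine le_trans ?_ (mul_abs_pow_sub_one_le_abs_pFun hk hM hε hε0)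
    gcongr
    exact max_one_abs_pow_le_abs_pow_sub_one (h.resolve_left hs) (not_le.1 hs).le

-- Where `p_ε` can vanish, the term `-(2n+1) p_ε'` is positive.
lemma half_le_potential_of_even (hk : 1 ≤ k) {n : ℕ} {ε y : ℝ}
    (hε : |ε| ≤ 1 / (k * (2 * (n : ℝ) + 2))) (hs : 1 + ε * y < 0) (hev : Even k) :
    1 / 2 ≤ potential k n ε y := by
  have hε0 : ε ≠ 0 := by
    rintro rfl
    norm_num at hs
  obtain ⟨t, ht⟩ : ∃ t, 1 + ε * y = -t := ⟨_, (neg_neg _).symm⟩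
  have ht0 : 0 < t := by linarith
  have hp := mul_abs_pow_sub_one_le_abs_pFun hk (by positivity) hε hε0 (y := y)
  rw [potential, ht, (Nat.Even.sub_odd hk hev odd_one).neg_pow, ← sq_abs (pFun k ε y)]
  rw [ht, hev.neg_pow] at hp
  rcases le_or_gt (1 / 2) (t ^ (k - 1)) with h | h
  · nlinarith [sq_nonneg |pFun k ε y|, n.cast_nonneg (α := ℝ)]
  · have ht1 : t < 1 := by
      by_contra! h1
      linarith [one_le_pow₀ (n := k - 1) h1]
    have htk : t ^ k ≤ 1 / 2 := by
      rw [← pow_sub_one_mul (by omega : k ≠ 0)]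
      nlinarith [pow_pos ht0 (k - 1)]
    have hp1 : 1 ≤ |pFun k ε y| := by
      nlinarith [neg_abs_le (t ^ k - 1), n.cast_nonneg (α := ℝ)]
    nlinarith [pow_pos ht0 (k - 1), n.cast_nonneg (α := ℝ)]

theorem exists_potential_lower_bound (hk : 1 ≤ k) (n : ℕ) :
    ∃ R₀ > 0, ∃ ε₀ > 0, ∀ ε y : ℝ, |ε| < ε₀ → R₀ ≤ |y| → 1 / 2 ≤ potential k n ε y := by
  refine ⟨k * (2 * n + 2), by positivity, 1 / (k * (2 * n + 2)), by positivity,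
    fun ε y hε hy => ?_⟩
  by_cases h : 0 ≤ 1 + ε * y ∨ Odd k
  · have hp := mul_max_one_abs_pow_le_abs_pFun hk (by positivity) hε.le hy h
    set m := max 1 (|1 + ε * y| ^ (k - 1))
    have hm1 : 1 ≤ m := le_max_left _ _
    have hm : (1 + ε * y) ^ (k - 1) ≤ m :=
      (le_abs_self _).trans ((abs_pow _ _).trans_le (le_max_right _ _))
    have hn : (0 : ℝ) ≤ n := n.cast_nonneg
    calc (1 / 2 : ℝ) ≤ ((2 * n + 2) * m) ^ 2 - (2 * n + 1) * m := by
          nlinarith [mul_nonneg hn (zero_le_one.trans hm1)]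
      _ ≤ |pFun k ε y| ^ 2 - (2 * n + 1) * (1 + ε * y) ^ (k - 1) := by gcongr
      _ = potential k n ε y := by rw [potential, sq_abs]
  · rw [not_or, not_le, Nat.not_odd_iff_even] at h
    exact half_le_potential_of_even hk hε.le h.1 h.2

/-- `p_ε(y)` as a polynomial in `ε` whose coefficients are polynomials in `y`. -/
noncomputable def pPoly (k : ℕ) : ℝ[X][X] :=
  C (C (1 / (k : ℝ)) * X) * ∑ i ∈ Finset.range k, (1 + C X * X) ^ i

/-- The perturbation `potential k n ε y - potential k n 0 y` as a polynomial in `ε` whose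
coefficients are polynomials in `y`. -/
noncomputable def perturbationPoly (k n : ℕ) : ℝ[X][X] :=
  pPoly k ^ 2 - C (C (2 * (n : ℝ) + 1)) * (1 + C X * X) ^ (k - 1)
    - C (X ^ 2 - C (2 * (n : ℝ) + 1))

lemma evalEval_one_add_C_X_mul_X_pow (m : ℕ) (ε y : ℝ) :
    ((1 + C X * X) ^ m : ℝ[X][X]).evalEval y ε = (1 + ε * y) ^ m := by
  rw [evalEval_pow, evalEval_add, evalEval_one, evalEval_mul, evalEval_C, eval_X, evalEval_X,
    mul_comm]

lemma evalEval_pPoly (hk : 1 ≤ k) (ε y : ℝ) : (pPoly k).evalEval y ε = pFun k ε y := by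
  rw [pFun_eq_mul_geom_sum hk, pPoly, evalEval_mul, evalEval_finsetSum, evalEval_C]
  simp only [evalEval_one_add_C_X_mul_X_pow, eval_mul, eval_C, eval_X]
  ring

lemma evalEval_perturbationPoly (hk : 1 ≤ k) (n : ℕ) (ε y : ℝ) :
    (perturbationPoly k n).evalEval y ε = potential k n ε y - potential k n 0 y := by
  rw [perturbationPoly, evalEval_sub, evalEval_sub, evalEval_pow, evalEval_pPoly hk, evalEval_mul,
    evalEval_C, evalEval_one_add_C_X_mul_X_pow, eval_C, evalEval_C, potential_zero, potential]
  simp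

lemma coeff_one_add_C_X_mul_X_pow (m i : ℕ) :
    ((1 + C X * X) ^ m : ℝ[X][X]).coeff i = (m.choose i : ℝ[X]) * X ^ i := by
  have h : ((1 + C X * X) ^ m : ℝ[X][X]) = ((1 + X) ^ m : ℝ[X][X]).comp (C X * X) := by simp
  rw [h, comp_C_mul_X_coeff, coeff_one_add_X_pow]

lemma sum_range_choose_eq_choose_succ (m i : ℕ) :
    ∑ j ∈ Finset.range m, j.choose i = m.choose (i + 1) := by
  induction m with
  | zero => simp
  | succ m ih => rw [Finset.sum_range_succ, ih, Nat.choose_succ_succ', add_comm]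

lemma coeff_pPoly (k i : ℕ) :
    (pPoly k).coeff i = C ((k.choose (i + 1) : ℝ) / k) * X ^ (i + 1) := by
  rw [pPoly, coeff_C_mul, finsetSum_coeff]
  simp only [coeff_one_add_C_X_mul_X_pow]
  rw [← Finset.sum_mul, ← Nat.cast_sum, sum_range_choose_eq_choose_succ]
  refine Polynomial.funext fun r => ?_
  simp only [one_div, eval_mul, eval_C, eval_X, eval_natCast, eval_pow]
  ring

lemma coeff_pPoly_zero (m : ℕ) : (pPoly (m + 1)).coeff 0 = X := by
  have hm : (m : ℝ) + 1 ≠ 0 := by positivity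
  simp [coeff_pPoly, hm]

lemma coeff_pPoly_one (m : ℕ) : (pPoly (m + 1)).coeff 1 = C ((m : ℝ) / 2) * X ^ 2 := by
  rw [coeff_pPoly, Nat.cast_choose_two]
  push_cast
  congr 2
  field_simp
  ring

lemma coeff_pPoly_two (m : ℕ) :
    (pPoly (m + 1)).coeff 2 = C ((m : ℝ) * (m - 1) / 6) * X ^ 3 := by
  have hchoose : ((m + 1).choose 3 : ℝ) = (m + 1) * m * (m - 1) / 6 := by
    rw [Nat.cast_choose_eq_descPochhammer_div]
    simp only [Nat.cast_add, Nat.cast_one, descPochhammer, one_comp, mul_one, X_comp, mul_comp,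
      sub_comp, eval_mul, eval_X, eval_sub, eval_one, add_sub_cancel_right, Nat.factorial,
      Nat.succ_eq_add_one, Nat.reduceAdd, zero_add, Nat.reduceMul, Nat.cast_ofNat, ne_eq,
      OfNat.ofNat_ne_zero, not_false_eq_true, div_left_inj']
    ring
  rw [coeff_pPoly, hchoose]
  push_cast
  congr 2
  field_simp

lemma coeff_perturbationPoly_zero (m n : ℕ) : (perturbationPoly (m + 1) n).coeff 0 = 0 := by
  rw [perturbationPoly, coeff_sub, coeff_sub, sq, mul_coeff_zero, coeff_C_mul,
    coeff_one_add_C_X_mul_X_pow, coeff_C_zero, coeff_pPoly_zero]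
  simp [sq]

lemma coeff_perturbationPoly_one (m n : ℕ) : (perturbationPoly (m + 1) n).coeff 1 =
    C (m : ℝ) * (X ^ 3 - C (2 * (n : ℝ) + 1) * X) := by
  rw [perturbationPoly, coeff_sub, coeff_sub, coeff_C_succ, sq, coeff_mul, coeff_C_mul,
    coeff_one_add_C_X_mul_X_pow, Finset.Nat.sum_antidiagonal_eq_sum_range_succ
      (fun i j => (pPoly (m + 1)).coeff i * (pPoly (m + 1)).coeff j)]
  simp only [Finset.sum_range_succ, Finset.sum_range_zero, Nat.sub_zero, Nat.sub_self,
    coeff_pPoly_zero, coeff_pPoly_one]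
  refine Polynomial.funext fun r => ?_
  simp only [zero_add, map_add, map_mul, map_natCast, map_one, add_tsub_cancel_right,
    Nat.choose_one_right, pow_one, sub_zero, eval_sub, eval_add, eval_mul, eval_X, eval_C, eval_pow,
    eval_natCast, eval_one]
  ring

lemma coeff_perturbationPoly_two (m n : ℕ) : (perturbationPoly (m + 1) n).coeff 2 =
    C ((m : ℝ) ^ 2 / 4 + m * (m - 1) / 3) * X ^ 4
      - C ((2 * (n : ℝ) + 1) * (m * (m - 1) / 2)) * X ^ 2 := by
  rw [perturbationPoly, coeff_sub, coeff_sub, coeff_C_succ, sq, coeff_mul, coeff_C_mul,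
    coeff_one_add_C_X_mul_X_pow, Finset.Nat.sum_antidiagonal_eq_sum_range_succ
      (fun i j => (pPoly (m + 1)).coeff i * (pPoly (m + 1)).coeff j)]
  simp only [Finset.sum_range_succ, Finset.sum_range_zero, Nat.sub_zero, Nat.sub_self,
    Nat.reduceSub, coeff_pPoly_zero, coeff_pPoly_one, coeff_pPoly_two]
  refine Polynomial.funext fun r => ?_
  simp only [zero_add, map_add, map_mul, map_natCast, map_one, add_tsub_cancel_right, sub_zero,
    eval_sub, eval_add, eval_mul, eval_X, eval_C, eval_pow, eval_natCast, eval_one,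
    Nat.cast_choose_two]
  ring

lemma exists_potential_sub_eq_mul (hk : 1 ≤ k) (n : ℕ) : ∃ T : ℝ[X][X],
    ∀ ε y : ℝ, potential k n ε y - potential k n 0 y = ε * T.evalEval y ε := by
  obtain ⟨m, rfl⟩ := Nat.exists_eq_add_of_le' hk
  obtain ⟨T, hT⟩ := X_dvd_iff.2 (coeff_perturbationPoly_zero m n)
  refine ⟨T, fun ε y => ?_⟩
  rw [← evalEval_perturbationPoly hk, hT, evalEval_mul, evalEval_X]

/-- A bound for `T(y, ε)` that is uniform in `|ε| ≤ 1`. -/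
noncomputable def coeffMajorant (T : ℝ[X][X]) (y : ℝ) : ℝ :=
  ∑ i ∈ Finset.range (T.natDegree + 1), |(T.coeff i).eval y|

lemma continuous_coeffMajorant (T : ℝ[X][X]) : Continuous (coeffMajorant T) :=
  continuous_finsetSum _ fun i _ => (T.coeff i).continuous.abs

lemma coeffMajorant_nonneg (T : ℝ[X][X]) (y : ℝ) : 0 ≤ coeffMajorant T y :=
  Finset.sum_nonneg fun _ _ => abs_nonneg _

lemma abs_evalEval_le_coeffMajorant (T : ℝ[X][X]) {ε : ℝ} (hε : |ε| ≤ 1) (y : ℝ) :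
    |T.evalEval y ε| ≤ coeffMajorant T y := by
  have heq : T.evalEval y ε = ∑ i ∈ Finset.range (T.natDegree + 1), (T.coeff i).eval y * ε ^ i := by
    rw [evalEval, eval_eq_sum_range (p := T), eval_finsetSum]
    simp
  rw [heq]
  refine (Finset.abs_sum_le_sum_abs _ _).trans (Finset.sum_le_sum fun i _ => ?_)
  rw [abs_mul, abs_pow]
  exact mul_le_of_le_one_right (abs_nonneg _) (pow_le_one₀ (abs_nonneg _) hε)

end Potential

section Eigenvalue

lemma IsSol.contDiff {q f f' : ℝ → ℝ} (hq : Continuous q) (h : IsSol q f f') :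
    ContDiff ℝ 2 f := by
  have h1 : deriv f = f' := funext fun y => (h.deriv₁ y).deriv
  have h2 : deriv f' = fun y => q y * f y := funext fun y => (h.deriv₂ y).deriv
  have hf' : ContDiff ℝ 1 f' := by
    rw [contDiff_one_iff_deriv, h2]
    exact ⟨fun y => (h.deriv₂ y).differentiableAt, hq.mul h.continuous⟩
  rw [show (2 : WithTop ℕ∞) = 1 + 1 by norm_num, contDiff_succ_iff_deriv, h1]
  exact ⟨fun y => (h.deriv₁ y).differentiableAt, by simp, hf'⟩

lemma opB_zero_left {k n : ℕ} (hk : 1 ≤ k) {a : ℝ → ℝ} (ha0 : a 0 = 2 * (n : ℝ) + 1)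
    (ζ : ℝ → ℝ) (ε : ℝ) (φ : ℝ → ℝ) (y : ℝ) :
    opB k a ζ 0 ε φ y = -deriv (deriv φ) y + potential k n ε y * φ y := by
  simp [opB, bFun, (hasDerivAt_pFun hk ε y).deriv, potential, ← ha0, iteratedDeriv_succ]

lemma isEigenvalueB_zero_iff {k n : ℕ} (hk : 1 ≤ k) {a : ℝ → ℝ} (ha0 : a 0 = 2 * (n : ℝ) + 1)
    (ζ : ℝ → ℝ) (ε μ : ℝ) :
    IsEigenvalueB k a ζ 0 ε μ ↔ IsL2Eigenvalue (potential k n ε) μ := by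
  constructor
  · rintro ⟨φ, hφ, hL, hne, heq⟩
    have hφ' : ContDiff ℝ 1 (deriv φ) := by
      rw [show (2 : WithTop ℕ∞) = 1 + 1 by norm_num, contDiff_succ_iff_deriv] at hφ
      exact hφ.2.2
    refine ⟨φ, deriv φ, ⟨fun y => ?_, fun y => ?_⟩, hL.integrable_sq, hne⟩
    · exact (hφ.differentiable (by norm_num) y).hasDerivAt
    · refine (hφ'.differentiable (by norm_num) y).hasDerivAt.congr_deriv ?_
      have h := heq y
      rw [opB_zero_left hk ha0] at h
      linarith
  · rintro ⟨φ, φ', hs, hL, hne⟩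
    have hφ' : deriv φ = φ' := funext fun y => (hs.deriv₁ y).deriv
    refine ⟨φ, hs.contDiff ((continuous_potential hk n ε).sub continuous_const),
      (memLp_two_iff_integrable_sq hs.continuous.aestronglyMeasurable).2 hL, hne, fun y => ?_⟩
    rw [opB_zero_left hk ha0, hφ', (hs.deriv₂ y).deriv]
    ring

end Eigenvalue

/-! ### Quasimodes -/

section Quasimode

open Polynomial

/-- A polynomial times the Gaussian `exp (-y²/2)`. -/
noncomputable def polyGauss (P : ℝ[X]) (y : ℝ) : ℝ := P.eval y * Real.exp (-(1 / 2) * y ^ 2)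

lemma hasDerivAt_polyGauss (P : ℝ[X]) (y : ℝ) :
    HasDerivAt (polyGauss P) (polyGauss (derivative P - X * P) y) y := by
  have hexp : HasDerivAt (fun y : ℝ => -(1 / 2) * y ^ 2) (-y) y :=
    ((hasDerivAt_pow 2 y).const_mul (-(1 / 2) : ℝ)).congr_deriv (by norm_num; ring)
  refine ((P.hasDerivAt y).mul hexp.exp).congr_deriv ?_
  simp only [polyGauss, eval_sub, eval_mul, eval_X]
  ring

lemma continuous_polyGauss (P : ℝ[X]) : Continuous (polyGauss P) :=
  continuous_iff_continuousAt.2 fun y => (hasDerivAt_polyGauss P y).continuousAt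

lemma integrable_polyGauss (P : ℝ[X]) : Integrable (polyGauss P) := by
  induction P using Polynomial.induction_on' with
  | add p q hp hq =>
    refine (hp.add hq).congr (Eventually.of_forall fun y => ?_)
    simp [polyGauss, add_mul]
  | monomial m a =>
    have h := (integrable_rpow_mul_exp_neg_mul_sq (b := 1 / 2) (by norm_num) (s := m)
      (lt_of_lt_of_le (by norm_num) (Nat.cast_nonneg m))).const_mul a
    refine h.congr (Eventually.of_forall fun y => ?_)
    simp [polyGauss, mul_assoc]

lemma tendsto_polyGauss (P : ℝ[X]) : Tendsto (polyGauss P) (cocompact ℝ) (𝓝 0) := by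
  rw [cocompact_eq_atBot_atTop, tendsto_sup]
  exact ⟨tendsto_zero_of_hasDerivAt_of_integrableOn_Iic (a := 0)
      (fun y _ => hasDerivAt_polyGauss P y) (integrable_polyGauss _).integrableOn
      (integrable_polyGauss _).integrableOn,
    tendsto_zero_of_hasDerivAt_of_integrableOn_Ioi (a := 0)
      (fun y _ => hasDerivAt_polyGauss P y) (integrable_polyGauss _).integrableOn
      (integrable_polyGauss _).integrableOn⟩

lemma abs_polyGauss (P : ℝ[X]) (y : ℝ) : |polyGauss P y| = |P.eval y| * polyGauss 1 y := by
  rw [polyGauss, polyGauss, abs_mul, abs_of_pos (Real.exp_pos _), eval_one, one_mul]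

lemma integrable_coeffMajorant_mul_polyGauss (T : ℝ[X][X]) (P : ℝ[X]) :
    Integrable fun y => coeffMajorant T y * polyGauss P y := by
  simp only [coeffMajorant, Finset.sum_mul]
  refine integrable_finsetSum _ fun i _ => (integrable_polyGauss (T.coeff i * P)).mono
    ((T.coeff i).continuous.abs.mul (continuous_polyGauss P)).aestronglyMeasurable
    (Eventually.of_forall fun y => le_of_eq ?_)
  simp [polyGauss, mul_assoc]

lemma abs_polyGauss_eval_C_le (T : ℝ[X][X]) {ε : ℝ} (hε : |ε| ≤ 1) (y : ℝ) :
    |polyGauss (T.eval (C ε)) y| ≤ coeffMajorant T y * polyGauss 1 y := by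
  rw [abs_polyGauss]
  refine mul_le_mul_of_nonneg_right (abs_evalEval_le_coeffMajorant T hε y) ?_
  simp [polyGauss, Real.exp_nonneg]

lemma hasDerivAt_polyGauss_derivative_sub (n : ℕ) (P : ℝ[X]) (y : ℝ) :
    HasDerivAt (polyGauss (derivative P - X * P))
      ((y ^ 2 - (2 * n + 1)) * polyGauss P y - polyGauss (oscillator n P) y) y := by
  refine (hasDerivAt_polyGauss _ y).congr_deriv ?_
  simp only [polyGauss, derivative_sub, derivative_mul, derivative_X, one_mul, eval_sub, eval_add,
    eval_mul, eval_X, one_div, neg_mul, oscillator_apply, map_mul, map_natCast, eval_neg,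
    eval_ofNat, eval_C, eval_natCast]
  ring

/-- The Hermite function, which spans the kernel of the unperturbed operator `B_{0,0}`. -/
noncomputable def hermiteFun (n : ℕ) : ℝ → ℝ := polyGauss (monicHermite n)

/-- The derivative of `hermiteFun n`. -/
noncomputable def hermiteFun' (n : ℕ) : ℝ → ℝ :=
  polyGauss (derivative (monicHermite n) - X * monicHermite n)

lemma isSol_hermiteFun (k n : ℕ) : IsSol (potential k n 0) (hermiteFun n) (hermiteFun' n) := by
  refine ⟨fun y => hasDerivAt_polyGauss _ y, fun y => ?_⟩
  refine (hasDerivAt_polyGauss_derivative_sub n _ y).congr_deriv ?_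
  simp [oscillator_monicHermite, potential_zero, hermiteFun, polyGauss]

lemma neg_one_pow_mul_hermiteFun_neg (n : ℕ) (y : ℝ) :
    (-1) ^ n * hermiteFun n (-y) = hermiteFun n y := by
  have h := congrArg (eval y) (monicHermite_comp_neg_X n)
  simp only [eval_comp, eval_neg, eval_X, eval_mul, eval_pow, eval_one] at h
  rw [hermiteFun, polyGauss, polyGauss, h, even_two.neg_pow, mul_assoc, ← mul_assoc, ← mul_pow]
  simp

lemma eventually_hermiteFun_pos (n : ℕ) : ∀ᶠ y in atTop, 0 < hermiteFun n y := by
  have h : ∀ᶠ y in atTop, 0 < (monicHermite n).eval y := by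
    rcases Nat.eq_zero_or_pos n with rfl | hn
    · simp [monicHermite]
    · refine (tendsto_atTop_of_leadingCoeff_nonneg _ ?_
        (by simp [(monic_monicHermite n).leadingCoeff])).eventually_gt_atTop 0
      rw [degree_monicHermite]
      exact_mod_cast hn
  filter_upwards [h] with y hy
  exact mul_pos hy (Real.exp_pos _)

lemma integrable_polyGauss_sq (P : ℝ[X]) : Integrable fun y => polyGauss P y ^ 2 := by
  refine Integrable.mono' (integrable_polyGauss (P ^ 2))
    ((continuous_polyGauss P).pow 2).aestronglyMeasurable (Eventually.of_forall fun y => ?_)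
  have hle : Real.exp (-(1 / 2) * y ^ 2) ≤ 1 := Real.exp_le_one_iff.2 (by nlinarith [sq_nonneg y])
  rw [Real.norm_of_nonneg (sq_nonneg _), polyGauss, polyGauss, eval_pow, mul_pow]
  gcongr
  exact pow_le_of_le_one (Real.exp_nonneg _) hle two_ne_zero

lemma isQuasimode_polyGauss {n : ℕ} {q : ℝ → ℝ} {μ₀ : ℝ} {P r : ℝ[X]}
    (hr : ∀ y, (oscillator n P).eval y + (q y - (y ^ 2 - (2 * n + 1)) - μ₀) * P.eval y = r.eval y) :
    IsQuasimode q μ₀ (polyGauss P) (polyGauss (derivative P - X * P)) (polyGauss r) where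
  deriv₁ := hasDerivAt_polyGauss P
  deriv₂ y := by
    refine (hasDerivAt_polyGauss_derivative_sub n P y).congr_deriv ?_
    simp only [polyGauss, ← hr]
    ring
  continuous_residual := continuous_polyGauss r
  tendsto := tendsto_polyGauss _
  tendsto' := tendsto_polyGauss _

lemma coeff_trunc_mk {R : Type*} [Semiring R] (a : ℕ → R) {N i : ℕ} (hi : i < N) :
    (PowerSeries.trunc N (PowerSeries.mk a)).coeff i = a i := by
  rw [PowerSeries.coeff_trunc, if_pos hi, PowerSeries.coeff_mk]

lemma eval_trunc_mk {R : Type*} [Semiring R] (a : ℕ → R) (N : ℕ) (x : R) :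
    (PowerSeries.trunc N (PowerSeries.mk a)).eval x = ∑ j ∈ Finset.range N, a j * x ^ j := by
  simp [eval, PowerSeries.eval₂_trunc_eq_sum_range]

lemma X_pow_dvd_of_perturbation_series {n : ℕ} {V : ℝ[X][X]} {Λ : ℕ → ℝ} {q : ℕ → ℝ[X]}
    (hq : ∀ j, oscillator n (q j) + ∑ il ∈ Finset.HasAntidiagonal.antidiagonal j,
      (V.coeff il.1 - C (Λ il.1)) * q il.2 = 0) (N : ℕ) :
    X ^ N ∣ PowerSeries.trunc N (PowerSeries.mk fun j => oscillator n (q j)) +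
      (V - PowerSeries.trunc N (PowerSeries.mk fun j => C (Λ j))) *
        PowerSeries.trunc N (PowerSeries.mk q) := by
  rw [X_pow_dvd_iff]
  intro d hd
  rw [coeff_add, coeff_trunc_mk _ hd, coeff_mul, ← hq d]
  congr 1
  refine Finset.sum_congr rfl fun il hil => ?_
  have hsum := Finset.HasAntidiagonal.mem_antidiagonal.1 hil
  rw [coeff_sub, coeff_trunc_mk _ (by omega), coeff_trunc_mk _ (by omega)]

lemma oscillator_eval_trunc_mk (n : ℕ) (q : ℕ → ℝ[X]) (N : ℕ) (ε : ℝ) :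
    oscillator n ((PowerSeries.trunc N (PowerSeries.mk q)).eval (C ε)) =
      (PowerSeries.trunc N (PowerSeries.mk fun j => oscillator n (q j))).eval (C ε) := by
  simp only [eval_trunc_mk, map_sum, ← C_pow, mul_comm _ (C _), ← smul_eq_C_mul, map_smul]

lemma oscillator_mul_monicHermite_add (n : ℕ) (a b : ℝ[X]) :
    oscillator n (a * monicHermite n + b * derivative (monicHermite n)) =
      (-derivative (derivative a) + 2 * X * derivative a + C (4 * (n : ℝ)) * derivative b) *
        monicHermite n +
      (-2 * derivative a - derivative (derivative b) - 2 * X * derivative b - 2 * b) *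
        derivative (monicHermite n) := by
  rw [oscillator_apply]
  simp only [derivative_add, derivative_mul, derivative_derivative_monicHermite, derivative_sub,
    derivative_C, derivative_X, derivative_ofNat]
  refine Polynomial.funext fun r => ?_
  simp only [map_mul, map_natCast, zero_mul, mul_one, zero_add, neg_add_rev, eval_sub, eval_add,
    eval_neg, eval_mul, eval_ofNat, eval_X, eval_C, eval_natCast, neg_mul]
  ring

-- Since `oscillator n` preserves the form `a * H + b * H'` with polynomial `a` and `b`, for `H` the
-- Hermite polynomial, the equations are solved by undetermined coefficients.
lemma exists_second_order_perturbation (m n : ℕ) : ∃ q₁ q₂ : ℝ[X],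
    oscillator n q₁ + (perturbationPoly (m + 1) n).coeff 1 * monicHermite n = 0 ∧
    oscillator n q₂ + (perturbationPoly (m + 1) n).coeff 1 * q₁ +
      ((perturbationPoly (m + 1) n).coeff 2 - C ((m : ℝ) * n * (n + 1) / 2)) *
        monicHermite n = 0 := by
  have hosc := oscillator_mul_monicHermite_add n
  set H := monicHermite n
  set H' := derivative H
  set ν : ℝ := (n : ℝ)
  set κ : ℝ := (m : ℝ)
  set a₄ : ℝ := (5 * κ ^ 2 / 12 - κ ^ 2 * (4 * ν + 1) / 6 - (κ ^ 2 / 4 + κ * (κ - 1) / 3)) / 8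
    with ha₄
  set b₃ : ℝ := -κ ^ 2 * (2 * ν + 1) / 24 - a₄ with hb₃
  set a₂ : ℝ := (κ ^ 2 * ν * (2 * ν + 1) / 3 + (2 * ν + 1) * (κ * (κ - 1) / 2) + 12 * a₄
    - 12 * ν * b₃) / 4 with ha₂
  set b₁ : ℝ := κ ^ 2 * (2 * ν + 1) ^ 2 / 24 - a₂ - 3 / 2 * b₃ with hb₁
  refine ⟨(C (-κ / 6) * X ^ 3 + C (ν * κ / 3) * X) * H +
      (C (κ / 6) * X ^ 2 - C (κ * (2 * ν + 1) / 6)) * H',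
    (C (κ ^ 2 / 72) * X ^ 6 + C a₄ * X ^ 4 + C a₂ * X ^ 2) * H +
      (C b₃ * X ^ 3 + C b₁ * X) * H', ?_, ?_⟩
  · rw [hosc, coeff_perturbationPoly_one]
    refine Polynomial.funext fun r => ?_
    simp only [derivative_mul, derivative_C, zero_mul, derivative_X_pow_succ, Nat.cast_ofNat,
      map_add, map_one, zero_add, derivative_X, mul_one, derivative_one, add_zero,
      Nat.cast_one, pow_one, map_mul, derivative_sub, sub_zero, neg_mul, map_natCast, eval_add,
      eval_mul, eval_neg, eval_C, eval_one, eval_X, eval_ofNat, eval_pow, eval_sub, eval_natCast,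
      eval_zero]
    ring
  · rw [hosc, coeff_perturbationPoly_one, coeff_perturbationPoly_two]
    refine Polynomial.funext fun r => ?_
    simp only [derivative_mul, derivative_C, zero_mul, derivative_X_pow_succ, Nat.cast_ofNat,
      map_add, map_one, zero_add, Nat.cast_one, pow_one, derivative_one, add_zero,
      derivative_X, mul_one, neg_add_rev, map_mul, neg_mul, map_natCast, eval_add, eval_mul,
      eval_neg, eval_C, eval_one, eval_pow, eval_X, eval_ofNat, eval_sub, eval_natCast, eval_zero]
    simp only [hb₁, ha₂, hb₃, ha₄]
    ring

theorem exists_potential_perturbation_series {k : ℕ} (hk : 1 ≤ k) (n : ℕ) :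
    ∃ (Λ : ℕ → ℝ) (q : ℕ → ℝ[X]), Λ 0 = 0 ∧ Λ 1 = 0 ∧ Λ 2 = ((k : ℝ) - 1) * n * (n + 1) / 2 ∧
      q 0 = monicHermite n ∧
      ∀ j, oscillator n (q j) + ∑ il ∈ Finset.HasAntidiagonal.antidiagonal j,
        ((perturbationPoly k n).coeff il.1 - C (Λ il.1)) * q il.2 = 0 := by
  obtain ⟨m, rfl⟩ := Nat.exists_eq_add_of_le' hk
  obtain ⟨q₁, q₂, h₁, h₂⟩ := exists_second_order_perturbation m n
  simpa using exists_perturbation_series n (coeff_perturbationPoly_zero m n) h₁ h₂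

theorem exists_quasimodes {k : ℕ} (hk : 1 ≤ k) (n : ℕ) : ∃ Λ : ℕ → ℝ,
    Λ 0 = 0 ∧ Λ 1 = 0 ∧ Λ 2 = ((k : ℝ) - 1) * n * (n + 1) / 2 ∧
    ∀ N, 1 ≤ N → ∃ G : ℝ → ℝ, Integrable G ∧ ∀ ε : ℝ, |ε| ≤ 1 → ∃ u u' r : ℝ → ℝ,
      IsQuasimode (potential k n ε) (∑ j ∈ Finset.range N, Λ j * ε ^ j) u u' r ∧
      (∀ y, |u y - hermiteFun n y| ≤ |ε| * G y) ∧ ∀ y, |r y| ≤ |ε| ^ N * G y := by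
  obtain ⟨Λ, q, hΛ0, hΛ1, hΛ2, hq0, hq⟩ := exists_potential_perturbation_series hk n
  refine ⟨Λ, hΛ0, hΛ1, hΛ2, fun N hN => ?_⟩
  set U : ℝ[X][X] := PowerSeries.trunc N (PowerSeries.mk q) with hU
  obtain ⟨T, hT⟩ := X_pow_dvd_of_perturbation_series hq N
  obtain ⟨T₀, hT₀⟩ : X ∣ U - C (monicHermite n) := by
    rw [X_dvd_iff, coeff_sub, hU, coeff_trunc_mk _ (by omega), hq0, coeff_C_zero, sub_self]
  have hpos : ∀ (T : ℝ[X][X]) y, 0 ≤ coeffMajorant T y * polyGauss 1 y := fun T y =>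
    mul_nonneg (coeffMajorant_nonneg T y) (by simp [polyGauss, Real.exp_nonneg])
  refine ⟨fun y => coeffMajorant T y * polyGauss 1 y + coeffMajorant T₀ y * polyGauss 1 y,
    (integrable_coeffMajorant_mul_polyGauss T 1).add (integrable_coeffMajorant_mul_polyGauss T₀ 1),
    fun ε hε => ⟨polyGauss (U.eval (C ε)), _, polyGauss (C (ε ^ N) * T.eval (C ε)),
      isQuasimode_polyGauss (n := n) fun y => ?_, fun y => ?_, fun y => ?_⟩⟩
  · have h := congrArg (evalEval y ε) hT
    have hV := evalEval_perturbationPoly hk n ε y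
    rw [potential_zero] at hV
    rw [oscillator_eval_trunc_mk]
    simp only [evalEval, eval_add, eval_mul, eval_sub, eval_pow, eval_X, eval_C,
      eval_trunc_mk (fun j => C (Λ j)), ← C_pow, ← C_mul, ← map_sum] at h hV ⊢
    linear_combination h - (U.eval (C ε)).eval y * hV
  · have h : polyGauss (U.eval (C ε)) y - hermiteFun n y =
        ε * polyGauss (T₀.eval (C ε)) y := by
      have h := congrArg (evalEval y ε) hT₀
      simp only [evalEval, eval_sub, eval_mul, eval_X, eval_C] at h
      rw [hermiteFun, polyGauss, polyGauss, polyGauss, ← sub_mul, h, mul_assoc]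
    rw [h, abs_mul]
    gcongr
    exact (abs_polyGauss_eval_C_le T₀ hε y).trans (le_add_of_nonneg_left (hpos T y))
  · rw [polyGauss, eval_mul, eval_C, mul_assoc, abs_mul, abs_pow]
    gcongr
    exact (abs_polyGauss_eval_C_le T hε y).trans (le_add_of_nonneg_right (hpos T₀ y))

end Quasimode

/-! ### The eigenvalue near zero -/

lemma exists_abs_potential_sub_sub_le {k : ℕ} (hk : 1 ≤ k) (n : ℕ) : ∃ D : ℝ → ℝ,
    Continuous D ∧ (∀ y, 0 ≤ D y) ∧ (Integrable fun y => D y * hermiteFun n y) ∧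
    ∀ ε μ y, |ε| ≤ 1 → |potential k n ε y - μ - potential k n 0 y| ≤ (|ε| + |μ|) * D y := by
  obtain ⟨T, hT⟩ := exists_potential_sub_eq_mul hk n
  refine ⟨fun y => coeffMajorant T y + 1, (continuous_coeffMajorant T).add continuous_const,
    fun y => add_nonneg (coeffMajorant_nonneg T y) zero_le_one, ?_, fun ε μ y hε => ?_⟩
  · simp only [add_mul, one_mul]
    exact (integrable_coeffMajorant_mul_polyGauss T _).add (integrable_polyGauss _)
  · have hTy := abs_evalEval_le_coeffMajorant T hε y
    calc |potential k n ε y - μ - potential k n 0 y|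
        = |ε * T.evalEval y ε - μ| := by rw [sub_right_comm, hT]
      _ ≤ |ε| * coeffMajorant T y + |μ| := by
        refine (abs_sub _ _).trans (add_le_add_left ?_ _)
        rw [abs_mul]
        gcongr
      _ ≤ (|ε| + |μ|) * (coeffMajorant T y + 1) := by
        nlinarith [abs_nonneg ε, mul_nonneg (abs_nonneg μ) (coeffMajorant_nonneg T y)]

lemma exists_pos_tracks_potential {k : ℕ} (hk : 1 ≤ k) (n : ℕ) {R ε₁ κ : ℝ} (hR : 0 < R)
    (hε₁ : 0 < ε₁) (hpot : ∀ ε y, |ε| < ε₁ → R ≤ |y| → 1 / 2 ≤ potential k n ε y)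
    (hhR : 0 < hermiteFun n R) (hκ : 0 < κ) :
    ∃ θ > 0, ∀ᶠ ε in 𝓝 (0 : ℝ), Tracks (potential k n ε) (hermiteFun n) R κ θ := by
  have hh : IsDecaying (potential k n 0) R (hermiteFun n) (hermiteFun' n) :=
    IsDecaying.of_integrableOn_sq (c := 1 / 2) (continuous_potential hk n 0) (by norm_num)
      (fun y hy => hpot 0 y (by simpa) (hy.trans (le_abs_self y))) (isSol_hermiteFun k n)
      (integrable_polyGauss_sq _).integrableOn hhR
  obtain ⟨D, hD, hD0, hDh, hqD⟩ := exists_abs_potential_sub_sub_le hk n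
  obtain ⟨C, hC0, hC⟩ := IsDecaying.exists_close_bound hR (continuous_potential hk n 0) hh hD hD0
    hDh.integrableOn 1
  obtain ⟨θ, ⟨hθ4, hCθ⟩, hθ⟩ : ∃ θ, (θ < 1 / 4 ∧ C * (θ + θ) < κ) ∧ 0 < θ := by
    have h4 : ∀ᶠ θ : ℝ in 𝓝[>] 0, θ < 1 / 4 :=
      nhdsWithin_le_nhds (eventually_lt_nhds (by norm_num))
    have hcont : Continuous fun θ : ℝ => C * (θ + θ) := by fun_prop
    have hκ' : ∀ᶠ θ : ℝ in 𝓝[>] 0, C * (θ + θ) < κ :=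
      nhdsWithin_le_nhds ((hcont.tendsto 0).eventually_lt_const (by simpa))
    exact ((h4.and hκ').and eventually_mem_nhdsWithin).exists
  refine ⟨θ, hθ, ?_⟩
  have habs : Tendsto (fun ε : ℝ => |ε|) (𝓝 0) (𝓝 0) := by
    simpa using continuous_abs.tendsto (0 : ℝ)
  filter_upwards [habs.eventually_lt_const hε₁, habs.eventually_lt_const hθ] with ε hε hεθ
  refine ⟨continuous_potential hk n ε, ⟨1 / 4, by norm_num, fun μ y hμ hy => ?_⟩,
    fun μ f f' hμ hf hfR y hy => ?_⟩
  · linarith [hpot ε y hε (hy.trans (le_abs_self y)), le_abs_self μ]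
  · have hfh := (hC _ ((continuous_potential hk n ε).sub continuous_const) (|ε| + |μ|)
      (by linarith) (by positivity) (fun y => hqD ε μ y (by linarith)) f f' hf hfR y hy).1
    exact hfh.trans ((mul_le_mul_of_nonneg_left (by linarith) hC0).trans hCθ.le)

theorem exists_isReference_tracks_potential {k : ℕ} (hk : 1 ≤ k) (n : ℕ) :
    ∃ R κ S B, IsReference (hermiteFun n) ((-1) ^ n) R κ S B ∧ ∃ θ > 0, ∀ᶠ ε in 𝓝 (0 : ℝ),
      Tracks (potential k n ε) (hermiteFun n) R κ θ ∧
      Tracks (fun y => potential k n ε (-y)) (hermiteFun n) R κ θ := by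
  obtain ⟨R₀, hR₀, ε₁, hε₁, hpot⟩ := exists_potential_lower_bound hk n
  obtain ⟨R, hRpos, hR₀R⟩ :=
    ((eventually_forall_ge_atTop.2 (eventually_hermiteFun_pos n)).and
      (eventually_ge_atTop R₀)).exists
  have hR : 0 < R := hR₀.trans_le hR₀R
  obtain ⟨κ, hκ, S, B, ref⟩ := exists_isReference (continuous_polyGauss _)
    (integrable_polyGauss _) (by rw [← mul_pow]; simp) (neg_one_pow_mul_hermiteFun_neg n) hR hRpos
  obtain ⟨θ, hθ, htracks⟩ := exists_pos_tracks_potential hk n hR hε₁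
    (fun ε y hε hy => hpot ε y hε (hR₀R.trans hy)) (hRpos R le_rfl) hκ
  have hneg : Tendsto (fun ε : ℝ => -ε) (𝓝 0) (𝓝 0) := by
    simpa using continuous_neg.tendsto (0 : ℝ)
  refine ⟨R, κ, S, B, ref, θ, hθ, htracks.and ((hneg.eventually htracks).mono fun ε hε => ?_)⟩
  simpa only [← potential_neg_neg k n ε, neg_neg] using hε

theorem IsReference.eventually_exists_eigenvalue {q : ℝ → ℝ → ℝ} {h m G : ℝ → ℝ}
    {σ R κ S B θ : ℝ} (ref : IsReference h σ R κ S B) (hθ : 0 < θ)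
    (hq : ∀ᶠ ε in 𝓝 (0 : ℝ), Tracks (q ε) h R κ θ ∧ Tracks (fun y => q ε (-y)) h R κ θ)
    (hm : Tendsto m (𝓝 0) (𝓝 0)) {N : ℕ} (hN : N ≠ 0) (hG : Integrable G)
    (hquasi : ∀ᶠ ε in 𝓝 (0 : ℝ), ∃ u u' r : ℝ → ℝ, IsQuasimode (q ε) (m ε) u u' r ∧
      (∀ y, |u y - h y| ≤ |ε| * G y) ∧ ∀ y, |r y| ≤ |ε| ^ N * G y) :
    ∃ K, ∀ᶠ ε in 𝓝 (0 : ℝ), ∃ μ,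
      (IsL2Eigenvalue (q ε) μ ∧ |μ| ≤ θ) ∧ |μ - m ε| ≤ K * |ε| ^ N := by
  have hS := ref.S_pos
  set K := |5 * (B * ∫ y, G y) / S|
  refine ⟨K, ?_⟩
  have small : ∀ (c : ℝ) {d : ℝ}, 0 < d → ∀ᶠ ε in 𝓝 (0 : ℝ), |ε| * c < d := fun c d hd => by
    have hcont : Continuous fun ε : ℝ => |ε| * c := by fun_prop
    exact (hcont.tendsto 0).eventually_lt_const (by simpa)
  have hmK : Tendsto (fun ε : ℝ => |m ε| + K * |ε| ^ N) (𝓝 0) (𝓝 0) := by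
    have hcont : Continuous fun ε : ℝ => K * |ε| ^ N := by fun_prop
    simpa [hN] using hm.abs.add (hcont.tendsto 0)
  filter_upwards [hq, hquasi, small (G R) (ref.pos R le_rfl), small (5 * (B * ∫ y, G y)) hS,
    hmK.eventually_lt_const hθ] with ε ⟨hright, hleft⟩ ⟨u, u', r, hu, huh, hr⟩ hγR hγ hmθ
  have hρ : 5 * (B * |ε| ^ N * ∫ y, G y) ≤ S * (K * |ε| ^ N) :=
    calc 5 * (B * |ε| ^ N * ∫ y, G y) = S * (5 * (B * ∫ y, G y) / S * |ε| ^ N) := by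
          field_simp
      _ ≤ S * (K * |ε| ^ N) := by gcongr; exact le_abs_self _
  obtain ⟨μ, hμ, hev⟩ := ref.exists_eigenvalue hright hleft hu hG huh hr hγR
    (by linarith) hρ (by positivity) hmθ.le
  exact ⟨μ, ⟨hev, by linarith [abs_sub_abs_le_abs_sub μ (m ε)]⟩, hμ⟩

lemma exists_hasAsymptoticExpansionAtZero {P : ℝ → ℝ → Prop} {Λ : ℕ → ℝ}
    (hunique : ∀ᶠ ε in 𝓝 (0 : ℝ), ∀ μ ν, P ε μ → P ε ν → μ = ν)
    (hex : ∀ N, ∃ K, ∀ᶠ ε in 𝓝 (0 : ℝ), ∃ μ,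
      P ε μ ∧ |μ - ∑ j ∈ Finset.range N, Λ j * ε ^ j| ≤ K * |ε| ^ N) :
    ∃ ε₀ > 0, ∃ lam : ℝ → ℝ, (∀ ε, |ε| < ε₀ → ∀ μ, P ε μ ↔ μ = lam ε) ∧
      HasAsymptoticExpansionAtZero lam Λ := by
  have hiff : ∀ᶠ ε in 𝓝 (0 : ℝ), ∃ ν, ∀ μ, P ε μ ↔ μ = ν := by
    obtain ⟨K, hK⟩ := hex 0
    filter_upwards [hunique, hK] with ε hε ⟨ν, hν, _⟩
    exact ⟨ν, fun μ => ⟨fun hμ => hε μ ν hμ hν, fun h => h ▸ hν⟩⟩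
  obtain ⟨lam, hlam⟩ := hiff.choice
  obtain ⟨ε₀, hε₀, hball⟩ := Metric.eventually_nhds_iff.1 hlam
  refine ⟨ε₀, hε₀, lam, fun ε hε => hball (by simpa using hε), fun N => ?_⟩
  obtain ⟨K, hK⟩ := hex N
  refine Asymptotics.IsBigO.of_bound K ?_
  filter_upwards [hlam, hK] with ε hε ⟨μ, hμ, hle⟩
  rwa [← (hε μ).1 hμ, norm_pow, Real.norm_eq_abs, Real.norm_eq_abs]

theorem lemma4p1_general (k n : ℕ) (hk : 1 ≤ k) (a ζ : ℝ → ℝ) (ha0 : a 0 = 2 * (n : ℝ) + 1) :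
    ∃ θ : ℝ, 0 < θ ∧ ∃ ε₀ : ℝ, 0 < ε₀ ∧ ∃ lam : ℝ → ℝ,
      (∀ ε : ℝ, |ε| < ε₀ → ∀ μ : ℝ,
        (IsEigenvalueB k a ζ 0 ε μ ∧ |μ| ≤ θ) ↔ μ = lam ε) ∧
      ∃ Λ : ℕ → ℝ, HasAsymptoticExpansionAtZero lam Λ ∧
        Λ 1 = 0 ∧ Λ 2 = ((k : ℝ) - 1) * n * (n + 1) / 2 := by
  simp only [isEigenvalueB_zero_iff hk ha0]
  obtain ⟨R, κ, S, B, ref, θ, hθ, htracks⟩ := exists_isReference_tracks_potential hk n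
  obtain ⟨Λ, hΛ0, hΛ1, hΛ2, hquasi⟩ := exists_quasimodes hk n
  have hexists : ∀ N ≠ 0, ∃ K, ∀ᶠ ε in 𝓝 (0 : ℝ), ∃ μ,
      (IsL2Eigenvalue (potential k n ε) μ ∧ |μ| ≤ θ) ∧
        |μ - ∑ j ∈ Finset.range N, Λ j * ε ^ j| ≤ K * |ε| ^ N := fun N hN => by
    obtain ⟨G, hG, hquasiN⟩ := hquasi N (Nat.one_le_iff_ne_zero.2 hN)
    have hm : Continuous fun ε : ℝ => ∑ j ∈ Finset.range N, Λ j * ε ^ j := by fun_prop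
    have hm0 : ∑ j ∈ Finset.range N, Λ j * (0 : ℝ) ^ j = 0 :=
      Finset.sum_eq_zero fun j _ => by rcases j with _ | j <;> simp [hΛ0]
    exact ref.eventually_exists_eigenvalue hθ htracks (by simpa only [hm0] using hm.tendsto 0) hN hG
      ((eventually_abs_sub_lt 0 one_pos).mono fun ε hε => hquasiN ε (by simpa using hε.le))
  obtain ⟨ε₀, hε₀, lam, hlam, hexp⟩ := exists_hasAsymptoticExpansionAtZero
    (P := fun ε μ => IsL2Eigenvalue (potential k n ε) μ ∧ |μ| ≤ θ)
    (htracks.mono fun ε hε μ ν hμ hν =>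
      ref.eigenvalue_unique hε.1 hε.2 hμ.2 hν.2 hμ.1 hν.1) fun N => by
    rcases eq_or_ne N 0 with rfl | hN
    · obtain ⟨K, hK⟩ := hexists 1 one_ne_zero
      exact ⟨θ, hK.mono fun ε ⟨μ, hμ, _⟩ => ⟨μ, hμ, by simpa using hμ.2⟩⟩
    · exact hexists N hN
  exact ⟨θ, hθ, ε₀, hε₀, lam, hlam, Λ, hexp, hΛ1, hΛ2⟩

theorem lemma4p1 (k n : ℕ) (hk : 1 ≤ k) (a ζ : ℝ → ℝ) (δ₀ : ℝ) (hδ₀ : 0 < δ₀)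
    (ha : ContDiff ℝ ∞ a) (hζ : IsCutoff δ₀ ζ) (ha0 : a 0 = 2 * (n : ℝ) + 1) :
    ∃ θ : ℝ, 0 < θ ∧ ∃ ε₀ : ℝ, 0 < ε₀ ∧ ∃ lam : ℝ → ℝ,
      (∀ ε : ℝ, |ε| < ε₀ → ∀ μ : ℝ,
        (IsEigenvalueB k a ζ 0 ε μ ∧ |μ| ≤ θ) ↔ μ = lam ε) ∧
      ∃ Λ : ℕ → ℝ, HasAsymptoticExpansionAtZero lam Λ ∧
        Λ 1 = 0 ∧ Λ 2 = ((k : ℝ) - 1) * n * (n + 1) / 2 :=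
  lemma4p1_general k n hk a ζ ha0
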